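/- Consider the discrete-time linear descriptor system $$E x_{k+1} = A x_k + B u_k + w_k,\qquad y_{k+1} = H x_{k+1} + v_k \qquad (k\ge 0),$$ with $x_k\in\mathbb{R}^n$, $u_k\in\mathbb{R}^q$, $y_k\in\mathbb{R}^m$, $E,A\in\mathbb{R}^{n_1\times n}$, $B\in\mathbb{R}^{n_1\times q}$, $H\in\mathbb{R}^{m\times n}$, and constraints $x_k\in\mathbb{X}$, $w_k\in\mathbb{W}$, $v_k\in\mathbb{V}$, where $\mathbb{X},\mathbb{W},\mathbb{V}$ are convex polyhedral sets and $0$ is an interior point of $\mathbb{W}$ and of $\mathbb{V}$. Let $Q\in\mathbb{R}^{n_1\times n_1}$, $R\in\mathbb{R}^{m\times m}$, $P_0\in\mathbb{R}^{n\times n}$ be symmetric positive definite, let $N\ge 0$ be an integer (the horizon length), and write $\|z\|_M^2 = z^T M^{-1} z$. Assume that the system is *detectable*, i.e. $\operatorname{rank}\begin{bmatrix}\mu E-\phi A\\ H\end{bmatrix}=n$ for all complex $(\mu,\phi)\neq(0,0)$ with $|\mu|\ge|\phi|$, and *stabilizable*, i.e. $\operatorname{rank}\begin{bmatrix}\mu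 E-\phi A& Q&0\\ \mu H&0&R\end{bmatrix}=n_1+m$ for almost all complex $(\mu,\phi)\neq(0,0)$ with $|\mu|\ge|\phi|$. *Estimator.* Given inputs $u_0,u_1,\dots$, measurements $y_1,y_2,\dots$ and an initial estimate $\bar x_0\in\mathbb{R}^n$, define the unconstrained descriptor Kalman filter by $\hat x_0^{(+)}=\bar x_0$, $P_0^{(+)}=P_0$ and $$P_k^{(-)}=AP_k^{(+)}A^T+Q\quad (k\ge 0),$$ $$P_k^{(+)}=\bigl(E^T(P_{k-1}^{(-)})^{-1}E+H^TR^{-1}H\bigr)^{-1},\qquad \hat x_k^{(+)}=P_k^{(+)}H^TR^{-1}y_k+P_k^{(+)}E^T(P_{k-1}^{(-)})^{-1}\bigl(A\hat x_{k-1}^{(+)}+Bu_{k-1}\bigr)\quad (k\ge 1).$$ For $T\ge 1$ put $s=\max(1,T-N)$. The moving horizon problem at time $T$ is to minimize $$\|Ex_s-A\hat x_{s-1}^{(+)}-Bu_{s-1}\|^2_{P_{s-1}^{(-)}}+\sum_{k=s}^{T-1}\|w_k\|_Q^2+\sum_{k=s-1}^{T-1}\|v_k\|_R^2$$ over $x_s,\dots,x_T\in\mathbb{X}$,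 $w_s,\dots,w_{T-1}\in\mathbb{W}$, $v_{s-1},\dots,v_{T-1}\in\mathbb{V}$ subject to $Ex_{k+1}=Ax_k+Bu_k+w_k$ for $s\le k\le T-1$ and $y_{k+1}=Hx_{k+1}+v_k$ for $s-1\le k\le T-1$. (For $T\le N$ this is the full information problem.) The estimate $\hat x_T^{mh}$ is the $x_T$ component of a minimizer. *Claim.* Suppose the data are noise-free: $Ex^*_{k+1}=Ax^*_k+Bu_k$, $y_{k+1}=Hx^*_{k+1}$ and $x^*_k\in\mathbb{X}$ for all $k\ge 0$. Then, for every such true trajectory and every $\bar x_0$, the estimate $\hat x_T^{mh}$ exists and is unique for every $T\ge1$, and $\|\hat x_T^{mh}-x_T^*\|\to0$ as $T\to\infty$. Furthermore, the moving horizon estimator is an asymptotically stable observer for the noise-free system: for every $\epsilon>0$ there are $\delta>0$ and a positive integer $\tilde T$, independent of the inputs, the true trajectory and $\bar x_0$, such that $\|Ex_1^*-A\bar x_0-Bu_0\|\le\delta$ implies $\|\hat x_T^{mh}-x_T^*\|\le\epsilon$ for all $T\ge\tilde T$; and $\hat x_T^{mh}-x_T^*\to0$ as $T\to\infty$. -/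

import Mathlib

open scoped Matrix

noncomputable section

namespace DescriptorMHE

/-- The matrices of the linear time-invariant descriptor system
`E x_{k+1} = A x_k + B u_k + w_k`, `y_{k+1} = H x_{k+1} + v_k`, with
`x_k ∈ ℝⁿ`, `w_k ∈ ℝ^{n₁}`, `u_k ∈ ℝ^q`, `y_k, v_k ∈ ℝ^m`. -/
structure DescriptorSystem (n n₁ m q : ℕ) where
  E : Matrix (Fin n₁) (Fin n) ℝ
  A : Matrix (Fin n₁) (Fin n) ℝ
  B : Matrix (Fin n₁) (Fin q) ℝ
  H : Matrix (Fin m) (Fin n) ℝ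

/-- A descriptor system together with the user-chosen data of a moving horizon estimator:
weighting matrices `Q`, `R`, initial uncertainty `P₀`, constraint sets for the states, the
disturbances and the measurement noise, and the horizon length `N`. -/
structure Estimator (n n₁ m q : ℕ) extends DescriptorSystem n n₁ m q where
  Q : Matrix (Fin n₁) (Fin n₁) ℝ
  R : Matrix (Fin m) (Fin m) ℝ
  P₀ : Matrix (Fin n) (Fin n) ℝ
  X : Set (Fin n → ℝ)
  W : Set (Fin n₁ → ℝ)
  V : Set (Fin m → ℝ)
  N : ℕ

/-- A convex polyhedral set: a finite intersection of closed half-spaces. -/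
def IsPolyhedral {d : ℕ} (S : Set (Fin d → ℝ)) : Prop :=
  ∃ (r : ℕ) (C : Matrix (Fin r) (Fin d) ℝ) (b : Fin r → ℝ), S = {z | ∀ i, (C *ᵥ z) i ≤ b i}

/-- The squared weighted norm `‖z‖²_M = zᵀ M⁻¹ z`. -/
def weightedSq {d : ℕ} (M : Matrix (Fin d) (Fin d) ℝ) (z : Fin d → ℝ) : ℝ :=
  z ⬝ᵥ (M⁻¹ *ᵥ z)

/-- The Euclidean norm on `ℝᵈ` (the default norm on `Fin d → ℝ` is the sup norm). -/
def euclNorm {d : ℕ} (z : Fin d → ℝ) : ℝ := ‖WithLp.toLp 2 z‖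

/-- The complex matrix with the same entries as a real matrix. -/
def complexify {a b : ℕ} (M : Matrix (Fin a) (Fin b) ℝ) : Matrix (Fin a) (Fin b) ℂ :=
  M.map (fun t : ℝ => (t : ℂ))

namespace DescriptorSystem

variable {n n₁ m q : ℕ}

/-- Detectability: `[μE - φA; H]` has rank `n` for all complex `(μ, φ) ≠ (0, 0)`
with `|μ| ≥ |φ|`. -/
def Detectable (S : DescriptorSystem n n₁ m q) : Prop :=
  ∀ μ φ : ℂ, (μ, φ) ≠ (0, 0) → ‖φ‖ ≤ ‖μ‖ →
    (Matrix.fromRows (μ • complexify S.E - φ • complexify S.A) (complexify S.H)).rank = n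

/-- Stabilizability with respect to noise weights `Q`, `R`: `[μE - φA, Q, 0; μH, 0, R]` has
rank `n₁ + m` for almost all complex `(μ, φ) ≠ (0, 0)` with `|μ| ≥ |φ|`. -/
def Stabilizable (S : DescriptorSystem n n₁ m q) (Q : Matrix (Fin n₁) (Fin n₁) ℝ)
    (R : Matrix (Fin m) (Fin m) ℝ) : Prop :=
  ∀ᵐ p : ℂ × ℂ, p ≠ (0, 0) → ‖p.2‖ ≤ ‖p.1‖ →
    (Matrix.fromRows
      (Matrix.fromCols (p.1 • complexify S.E - p.2 • complexify S.A)
        (Matrix.fromCols (complexify Q) (0 : Matrix (Fin n₁) (Fin m) ℂ)))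
      (Matrix.fromCols (p.1 • complexify S.H)
        (Matrix.fromCols (0 : Matrix (Fin m) (Fin n₁) ℂ) (complexify R)))).rank = n₁ + m

end DescriptorSystem

namespace Estimator

variable {n n₁ m q : ℕ}

/-- The filter covariances `P_k⁽⁺⁾`: `P_0⁽⁺⁾ = P₀`, and
`P_{k+1}⁽⁺⁾ = (Eᵀ (P_k⁽⁻⁾)⁻¹ E + Hᵀ R⁻¹ H)⁻¹` with `P_k⁽⁻⁾ = A P_k⁽⁺⁾ Aᵀ + Q`. -/
def covPlus (S : Estimator n n₁ m q) : ℕ → Matrix (Fin n) (Fin n) ℝ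
  | 0 => S.P₀
  | k + 1 => (S.Eᵀ * (S.A * covPlus S k * S.Aᵀ + S.Q)⁻¹ * S.E + S.Hᵀ * S.R⁻¹ * S.H)⁻¹

/-- The predicted covariances `P_k⁽⁻⁾ = A P_k⁽⁺⁾ Aᵀ + Q`. -/
def covMinus (S : Estimator n n₁ m q) (k : ℕ) : Matrix (Fin n₁) (Fin n₁) ℝ :=
  S.A * S.covPlus k * S.Aᵀ + S.Q

/-- The unconstrained descriptor Kalman filter estimates `x̂_k⁽⁺⁾`, started at the initial
estimate `xbar` and driven by the inputs `u` and the measurements `y 1, y 2, …`. -/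
def kalman (S : Estimator n n₁ m q) (u : ℕ → Fin q → ℝ) (y : ℕ → Fin m → ℝ)
    (xbar : Fin n → ℝ) : ℕ → Fin n → ℝ
  | 0 => xbar
  | k + 1 =>
      (S.covPlus (k + 1) * S.Hᵀ * S.R⁻¹) *ᵥ y (k + 1) +
        (S.covPlus (k + 1) * S.Eᵀ * (S.covMinus k)⁻¹) *ᵥ
          (S.A *ᵥ kalman S u y xbar k + S.B *ᵥ u k)

/-- First time index of the estimation window at time `T`: it is `T - N` once `T > N`; for
`1 ≤ T ≤ N` it is `1`, and the window problem is the full information problem. -/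
def windowStart (S : Estimator n n₁ m q) (T : ℕ) : ℕ := max 1 (T - S.N)

/-- The prior weighting
`Z̄_s(z) = ‖E z - A x̂_{s-1}⁽⁺⁾ - B u_{s-1}‖²` in the weight `P_{s-1}⁽⁻⁾`, for `s ≥ 1`:
the arrival cost of the unconstrained problem without its constant term. -/
def arrivalCost (S : Estimator n n₁ m q) (u : ℕ → Fin q → ℝ) (y : ℕ → Fin m → ℝ)
    (xbar : Fin n → ℝ) (s : ℕ) (z : Fin n → ℝ) : ℝ :=
  weightedSq (S.covMinus (s - 1))
    (S.E *ᵥ z - S.A *ᵥ S.kalman u y xbar (s - 1) - S.B *ᵥ u (s - 1))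

/-- Decision variables of a window problem: states, disturbances and measurement noises.
Only the entries inside the window matter. -/
structure Decision (n n₁ m : ℕ) where
  x : ℕ → Fin n → ℝ
  w : ℕ → Fin n₁ → ℝ
  v : ℕ → Fin m → ℝ

/-- Feasibility for the window problem at time `T`, with window start `s`: the states
`x_s, …, x_T`, disturbances `w_s, …, w_{T-1}` and noises `v_{s-1}, …, v_{T-1}` (those of the
measurements `y_s, …, y_T`) satisfy the constraints and the system equations. -/
def Feasible (S : Estimator n n₁ m q) (u : ℕ → Fin q → ℝ) (y : ℕ → Fin m → ℝ) (T : ℕ)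
    (ζ : Decision n n₁ m) : Prop :=
  (∀ k ∈ Finset.Icc (S.windowStart T) T, ζ.x k ∈ S.X) ∧
  (∀ k ∈ Finset.Ico (S.windowStart T) T, ζ.w k ∈ S.W) ∧
  (∀ k ∈ Finset.Ico (S.windowStart T - 1) T, ζ.v k ∈ S.V) ∧
  (∀ k ∈ Finset.Ico (S.windowStart T) T,
    S.E *ᵥ ζ.x (k + 1) = S.A *ᵥ ζ.x k + S.B *ᵥ u k + ζ.w k) ∧
  (∀ k ∈ Finset.Ico (S.windowStart T - 1) T, y (k + 1) = S.H *ᵥ ζ.x (k + 1) + ζ.v k)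

/-- The moving horizon objective at time `T`. -/
def cost (S : Estimator n n₁ m q) (u : ℕ → Fin q → ℝ) (y : ℕ → Fin m → ℝ)
    (xbar : Fin n → ℝ) (T : ℕ) (ζ : Decision n n₁ m) : ℝ :=
  S.arrivalCost u y xbar (S.windowStart T) (ζ.x (S.windowStart T)) +
    ∑ k ∈ Finset.Ico (S.windowStart T) T, weightedSq S.Q (ζ.w k) +
    ∑ k ∈ Finset.Ico (S.windowStart T - 1) T, weightedSq S.R (ζ.v k)

/-- `ζ` solves the moving horizon minimization problem at time `T`. -/
def IsOptimal (S : Estimator n n₁ m q) (u : ℕ → Fin q → ℝ) (y : ℕ → Fin m → ℝ)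
    (xbar : Fin n → ℝ) (T : ℕ) (ζ : Decision n n₁ m) : Prop :=
  S.Feasible u y T ζ ∧ ∀ ζ', S.Feasible u y T ζ' → S.cost u y xbar T ζ ≤ S.cost u y xbar T ζ'

/-- `z` is a moving horizon estimate of the state at time `T`: the `x_T` entry of a solution of
the minimization problem at time `T`. -/
def IsEstimate (S : Estimator n n₁ m q) (u : ℕ → Fin q → ℝ) (y : ℕ → Fin m → ℝ)
    (xbar : Fin n → ℝ) (T : ℕ) (z : Fin n → ℝ) : Prop :=
  ∃ ζ, S.IsOptimal u y xbar T ζ ∧ ζ.x T = z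

/-- `xhat 1, xhat 2, …` are the moving horizon estimates produced by the iterative
minimization. -/
def IsEstimateSequence (S : Estimator n n₁ m q) (u : ℕ → Fin q → ℝ) (y : ℕ → Fin m → ℝ)
    (xbar : Fin n → ℝ) (xhat : ℕ → Fin n → ℝ) : Prop :=
  ∀ T, 1 ≤ T → S.IsEstimate u y xbar T (xhat T)

/-- `x` is a state trajectory of the noise-free system with inputs `u`, satisfying the state
constraints, and `y 1, y 2, …` are its noise-free measurements. -/
def IsTrueTrajectory (S : Estimator n n₁ m q) (u : ℕ → Fin q → ℝ) (y : ℕ → Fin m → ℝ)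
    (x : ℕ → Fin n → ℝ) : Prop :=
  (∀ k, S.E *ᵥ x (k + 1) = S.A *ᵥ x k + S.B *ᵥ u k) ∧
  (∀ k, y (k + 1) = S.H *ᵥ x (k + 1)) ∧
  (∀ k, x k ∈ S.X)

/-- The moving horizon estimator is an asymptotically stable observer for the noise-free
system. Both `δ` and `T₀` depend on `ε` only: not on the inputs, the trajectory or the initial
estimate. -/
def IsAsymptoticallyStableObserver (S : Estimator n n₁ m q) : Prop :=
  (∀ ε : ℝ, 0 < ε → ∃ δ : ℝ, 0 < δ ∧ ∃ T₀ : ℕ, 0 < T₀ ∧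
    ∀ (u : ℕ → Fin q → ℝ) (y : ℕ → Fin m → ℝ) (x : ℕ → Fin n → ℝ) (xbar : Fin n → ℝ)
      (xhat : ℕ → Fin n → ℝ),
      S.IsTrueTrajectory u y x → S.IsEstimateSequence u y xbar xhat →
      euclNorm (S.E *ᵥ x 1 - S.A *ᵥ xbar - S.B *ᵥ u 0) ≤ δ →
      ∀ T, T₀ ≤ T → euclNorm (xhat T - x T) ≤ ε) ∧
  (∀ (u : ℕ → Fin q → ℝ) (y : ℕ → Fin m → ℝ) (x : ℕ → Fin n → ℝ) (xbar : Fin n → ℝ)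
      (xhat : ℕ → Fin n → ℝ),
      S.IsTrueTrajectory u y x → S.IsEstimateSequence u y xbar xhat →
      Filter.Tendsto (fun T => euclNorm (xhat T - x T)) Filter.atTop (nhds 0))

end Estimator

end DescriptorMHE

end

/-! Everything rests on one quantitative form of detectability, `Detectable.exists_energy_bound`.
The pencil `[E - zA; H]` has full column rank on the closed unit disc, so it has a polynomial left
inverse up to a scalar denominator with no zeros there. Division by such a denominator is bounded in
ℓ², uniformly in the truncation, so a state sequence is controlled by its initial data, equation
residuals and outputs with a constant independent of its length.

For the filter, the weight of `covPlus k` at `z` is the cost of some sequence ending in `z`, so the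
energy bound makes all covariances uniformly bounded. The error weight is a Lyapunov function: each
update lowers it by the weighted residuals (`kalmanError_balance`). The residuals of the error are
therefore square summable, the energy bound makes the error itself square summable, and the
predicted weight decreases to zero.

For the window problem, the objective satisfies a parallelogram law whose defect is a homogeneous
energy dominating every state in the window, uniformly in time (`exists_normSq_sub_le`). This yields
compactness of the relevant competitors and uniqueness. The true trajectory is feasible and costs
exactly the predicted weight just before the window, so the squared estimation error is at most a
constant times that weight. Convergence follows because the window start tends to infinity, and
stability because the weight is antitone. -/

noncomputable section

namespace DescriptorMHE

/-! ### Polynomial left inverses over the closed unit disc -/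

open Polynomial in
/-- The common denominators of the polynomial left inverses of a polynomial matrix. -/
def leftDenominators {ρ κ : Type*} [Fintype ρ] [Fintype κ] [DecidableEq κ]
    (P : Matrix ρ κ ℂ[X]) : Ideal ℂ[X] where
  carrier := {g | ∃ M : Matrix κ ρ ℂ[X], M * P = g • (1 : Matrix κ κ ℂ[X])}
  add_mem' := by
    rintro a b ⟨M, hM⟩ ⟨M', hM'⟩
    exact ⟨M + M', by rw [Matrix.add_mul, hM, hM', add_smul]⟩
  zero_mem' := ⟨0, by simp⟩
  smul_mem' := by
    rintro c a ⟨M, hM⟩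
    exact ⟨c • M, by rw [Matrix.smul_mul, hM, smul_smul, smul_eq_mul]⟩

lemma exists_left_inverse_of_rank_eq {K ρ κ : Type*} [Field K] [Fintype ρ] [Fintype κ]
    [DecidableEq κ] (M : Matrix ρ κ K) (h : M.rank = Fintype.card κ) :
    ∃ L : Matrix κ ρ K, L * M = 1 := by
  classical
  have hker : LinearMap.ker M.mulVecLin = ⊥ := by
    have h1 := LinearMap.finrank_range_add_finrank_ker M.mulVecLin
    rw [Module.finrank_fintype_fun_eq_card] at h1
    have h2 : Module.finrank K (LinearMap.range M.mulVecLin) = Fintype.card κ := h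
    exact Submodule.finrank_eq_zero.mp (by omega)
  obtain ⟨g, hg⟩ := LinearMap.exists_leftInverse_of_injective M.mulVecLin hker
  refine ⟨LinearMap.toMatrix' g, ?_⟩
  apply Matrix.toLin'.injective
  rw [Matrix.toLin'_mul, Matrix.toLin'_toMatrix', Matrix.toLin'_one]
  exact hg

open Polynomial in
/-- A polynomial matrix which has full column rank at every point of the closed unit disc has a
left inverse whose common denominator has no zeros in the closed unit disc. -/
lemma exists_polynomial_left_inverse {ρ κ : Type*} [Fintype ρ] [Fintype κ] [DecidableEq κ]
    (P : Matrix ρ κ ℂ[X])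
    (hP : ∀ z : ℂ, ‖z‖ ≤ 1 → (P.map (eval z)).rank = Fintype.card κ) :
    ∃ (M : Matrix κ ρ ℂ[X]) (g : ℂ[X]), M * P = g • (1 : Matrix κ κ ℂ[X]) ∧
      ∀ z : ℂ, ‖z‖ ≤ 1 → g.eval z ≠ 0 := by
  set g := Submodule.IsPrincipal.generator (leftDenominators P) with hg
  obtain ⟨M, hM⟩ : g ∈ leftDenominators P := Submodule.IsPrincipal.generator_mem _
  refine ⟨M, g, hM, fun z hz hgz => ?_⟩
  obtain ⟨L, hL⟩ := exists_left_inverse_of_rank_eq _ (hP z hz)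
  -- A constant left inverse at `z` gives `D` with `D(z) = 1`. The adjugate puts `det D` in the
  -- ideal, so the generator divides a polynomial with value 1 at `z` and cannot vanish there.
  set D : Matrix κ κ ℂ[X] := L.map C * P with hD
  have hmem : D.det ∈ leftDenominators P :=
    ⟨D.adjugate * L.map C, by rw [Matrix.mul_assoc, ← hD, Matrix.adjugate_mul]⟩
  have hdvd : g ∣ D.det := (Submodule.IsPrincipal.mem_iff_generator_dvd _).mp hmem
  have hdet : D.det.eval z = 1 := by
    have h1 : D.map (evalRingHom z) = 1 := by
      rw [hD, Matrix.map_mul, ← hL]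
      congr 1
      ext i j
      simp
    have h2 := RingHom.map_det (evalRingHom z) D
    rw [RingHom.mapMatrix_apply, h1, Matrix.det_one] at h2
    exact h2
  obtain ⟨q, hq⟩ := hdvd
  rw [hq, eval_mul, hgz, zero_mul] at hdet
  exact zero_ne_one hdet

/-! ### Truncated ℓ² bounds for power series -/

open PowerSeries in
/-- The `ℓ²` norm of the coefficients of degree at most `k` of a power series. -/
def truncNorm (k : ℕ) (x : ℂ⟦X⟧) : ℝ :=
  ‖WithLp.toLp 2 (fun j : Fin (k + 1) => coeff (j : ℕ) x)‖

section truncNorm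

open PowerSeries

lemma truncNorm_nonneg (k : ℕ) (x : ℂ⟦X⟧) : 0 ≤ truncNorm k x := norm_nonneg _

lemma truncNorm_sq (k : ℕ) (x : ℂ⟦X⟧) :
    truncNorm k x ^ 2 = ∑ j ∈ Finset.range (k + 1), ‖coeff j x‖ ^ 2 := by
  rw [truncNorm, EuclideanSpace.norm_sq_eq, Finset.sum_range]

lemma truncNorm_add_le (k : ℕ) (x y : ℂ⟦X⟧) :
    truncNorm k (x + y) ≤ truncNorm k x + truncNorm k y := by
  unfold truncNorm
  refine le_trans (le_of_eq ?_) (norm_add_le _ _)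
  congr 1

lemma truncNorm_C_mul (k : ℕ) (c : ℂ) (x : ℂ⟦X⟧) :
    truncNorm k (C c * x) = ‖c‖ * truncNorm k x := by
  unfold truncNorm
  rw [← norm_smul]
  congr 1
  ext j
  simp

/-- The shift only pushes the top coefficient out of the truncation. -/
lemma truncNorm_X_mul_le (k : ℕ) (x : ℂ⟦X⟧) : truncNorm k (X * x) ≤ truncNorm k x := by
  refine le_of_sq_le_sq ?_ (truncNorm_nonneg _ _)
  rw [truncNorm_sq, truncNorm_sq, Finset.sum_range_succ', Finset.sum_range_succ]
  simp only [coeff_succ_X_mul, coeff_zero_X_mul]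
  simp

lemma truncNorm_zero (k : ℕ) : truncNorm k 0 = 0 := by
  have := truncNorm_C_mul k 0 0
  simpa using this

lemma truncNorm_sum_le {ι : Type*} (s : Finset ι) (k : ℕ) (f : ι → ℂ⟦X⟧) :
    truncNorm k (∑ i ∈ s, f i) ≤ ∑ i ∈ s, truncNorm k (f i) := by
  classical
  induction s using Finset.induction_on with
  | empty => simp [truncNorm_zero]
  | insert a s ha ih =>
    rw [Finset.sum_insert ha, Finset.sum_insert ha]
    exact (truncNorm_add_le _ _ _).trans (by gcongr)

/-- Multiplication by a polynomial is bounded, uniformly in the truncation. -/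
lemma exists_truncNorm_mul_le (p : Polynomial ℂ) :
    ∃ c : ℝ, 0 ≤ c ∧ ∀ k x, truncNorm k ((p : ℂ⟦X⟧) * x) ≤ c * truncNorm k x := by
  induction p using Polynomial.induction_on with
  | C a =>
    refine ⟨‖a‖, norm_nonneg _, fun k x => ?_⟩
    rw [Polynomial.coe_C, truncNorm_C_mul]
  | add p q hp hq =>
    obtain ⟨c, hc, h⟩ := hp
    obtain ⟨c', hc', h'⟩ := hq
    refine ⟨c + c', by positivity, fun k x => ?_⟩
    rw [Polynomial.coe_add, add_mul, add_mul]
    exact (truncNorm_add_le _ _ _).trans (add_le_add (h k x) (h' k x))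
  | monomial m a h =>
    obtain ⟨c, hc, h⟩ := h
    refine ⟨c, hc, fun k x => ?_⟩
    have : ((Polynomial.C a * Polynomial.X ^ (m + 1) : Polynomial ℂ) : ℂ⟦X⟧) * x =
        X * (((Polynomial.C a * Polynomial.X ^ m : Polynomial ℂ) : ℂ⟦X⟧) * x) := by
      push_cast
      ring
    rw [this]
    exact (truncNorm_X_mul_le _ _).trans (h k x)

/-- Division by a linear factor with its zero outside of the closed unit disc is bounded. -/
lemma truncNorm_le_of_X_sub_C_mul {r : ℂ} (hr : 1 < ‖r‖) (k : ℕ) (x : ℂ⟦X⟧) :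
    truncNorm k x ≤ (‖r‖ - 1)⁻¹ * truncNorm k ((X - C r) * x) := by
  have h1 : C r * x = X * x + C (-1) * ((X - C r) * x) := by
    rw [map_neg, map_one]; ring
  have h2 : ‖r‖ * truncNorm k x ≤ truncNorm k x + truncNorm k ((X - C r) * x) := by
    rw [← truncNorm_C_mul, h1]
    refine (truncNorm_add_le _ _ _).trans (add_le_add (truncNorm_X_mul_le _ _) ?_)
    rw [truncNorm_C_mul]; simp
  rw [inv_mul_eq_div, le_div_iff₀ (by linarith)]
  linarith

lemma exists_truncNorm_le_of_prod_mul (s : Multiset ℂ) (hs : ∀ r ∈ s, 1 < ‖r‖) :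
    ∃ c : ℝ, 0 ≤ c ∧ ∀ k (x : ℂ⟦X⟧), truncNorm k x ≤
      c * truncNorm k ((((s.map fun r => Polynomial.X - Polynomial.C r).prod :
        Polynomial ℂ) : ℂ⟦X⟧) * x) := by
  induction s using Multiset.induction_on with
  | empty => exact ⟨1, zero_le_one, fun k x => by simp⟩
  | cons r s ih =>
    obtain ⟨c, hc, h⟩ := ih fun t ht => hs t (Multiset.mem_cons_of_mem ht)
    have hr := hs r (Multiset.mem_cons_self r s)
    have hr' : 0 ≤ (‖r‖ - 1)⁻¹ := inv_nonneg.mpr (by linarith)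
    refine ⟨c * (‖r‖ - 1)⁻¹, by positivity, fun k x => (h k x).trans ?_⟩
    rw [mul_assoc]
    refine mul_le_mul_of_nonneg_left ?_ hc
    rw [Multiset.map_cons, Multiset.prod_cons, Polynomial.coe_mul, mul_assoc]
    simpa using truncNorm_le_of_X_sub_C_mul hr k _

/-- Division by a polynomial without zeros in the closed unit disc is bounded, uniformly in the
truncation. -/
lemma exists_truncNorm_le_of_mul (g : Polynomial ℂ) (hg : ∀ z : ℂ, ‖z‖ ≤ 1 → g.eval z ≠ 0) :
    ∃ c : ℝ, 0 ≤ c ∧ ∀ k x, truncNorm k x ≤ c * truncNorm k ((g : ℂ⟦X⟧) * x) := by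
  have hg0 : g ≠ 0 := by
    rintro rfl
    exact hg 0 (by simp) (by simp)
  have hroots : ∀ r ∈ g.roots, 1 < ‖r‖ := fun r hr => by
    by_contra! h
    exact hg r h (Polynomial.isRoot_of_mem_roots hr)
  obtain ⟨c, hc, h⟩ := exists_truncNorm_le_of_prod_mul g.roots hroots
  have hlead : 0 < ‖g.leadingCoeff‖ := norm_pos_iff.mpr (by simpa using hg0)
  refine ⟨c * ‖g.leadingCoeff‖⁻¹, by positivity, fun k x => (h k x).trans ?_⟩
  rw [mul_assoc]
  refine mul_le_mul_of_nonneg_left ?_ hc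
  have hfac : (g : ℂ⟦X⟧) * x = C g.leadingCoeff *
      ((((g.roots.map fun r => Polynomial.X - Polynomial.C r).prod : Polynomial ℂ) : ℂ⟦X⟧) * x) := by
    conv_lhs => rw [(IsAlgClosed.splits g).eq_prod_roots]
    rw [Polynomial.coe_mul, mul_assoc, Polynomial.coe_C]
  rw [hfac, truncNorm_C_mul, inv_mul_cancel_left₀ hlead.ne']

/-- A polynomial matrix with full column rank on the closed unit disc is bounded below on vectors
of power series, uniformly in the truncation. -/
lemma exists_sum_truncNorm_sq_le {ρ κ : Type*} [Fintype ρ] [Fintype κ] [DecidableEq κ]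
    (P : Matrix ρ κ (Polynomial ℂ))
    (hP : ∀ z : ℂ, ‖z‖ ≤ 1 → (P.map (Polynomial.eval z)).rank = Fintype.card κ) :
    ∃ c : ℝ, 0 ≤ c ∧ ∀ k (d : κ → ℂ⟦X⟧), ∑ i, truncNorm k (d i) ^ 2 ≤
      c * ∑ r, truncNorm k ((P.map (fun p => (p : ℂ⟦X⟧)) *ᵥ d) r) ^ 2 := by
  obtain ⟨M, g, hM, hg⟩ := exists_polynomial_left_inverse P hP
  obtain ⟨c, hc, h⟩ := exists_truncNorm_le_of_mul g hg
  choose b hb hb' using fun i r => exists_truncNorm_mul_le (M i r)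
  have key : ∀ k (d : κ → ℂ⟦X⟧) i, truncNorm k (d i) ^ 2 ≤
      (c ^ 2 * ∑ r, b i r ^ 2) *
        ∑ r, truncNorm k ((P.map (fun p => (p : ℂ⟦X⟧)) *ᵥ d) r) ^ 2 := by
    intro k d i
    set f := P.map (fun p => (p : ℂ⟦X⟧)) *ᵥ d with hf
    -- Apply the left inverse `M` to `f = P d`, over power series.
    have h1 : (g : ℂ⟦X⟧) * d i = ∑ r, (M i r : ℂ⟦X⟧) * f r := by
      have h2 := congrArg (fun N => (N.map Polynomial.coeToPowerSeries.ringHom *ᵥ d) i) hM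
      simp only [Matrix.map_mul, ← Matrix.mulVec_mulVec] at h2
      have h3 : ((g • (1 : Matrix κ κ (Polynomial ℂ))).map
          Polynomial.coeToPowerSeries.ringHom *ᵥ d) i = (g : ℂ⟦X⟧) * d i := by
        have h4 : (g • (1 : Matrix κ κ (Polynomial ℂ))).map
          Polynomial.coeToPowerSeries.ringHom = (g : ℂ⟦X⟧) • (1 : Matrix κ κ ℂ⟦X⟧) := by
          ext1 a b
          by_cases hab : a = b <;> simp [hab]
        rw [h4, Matrix.smul_mulVec, Matrix.one_mulVec, Pi.smul_apply, smul_eq_mul]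
      rw [h3] at h2
      rw [← h2]
      rfl
    have h5 : truncNorm k (d i) ≤ c * ∑ r, b i r * truncNorm k (f r) := by
      refine (h k (d i)).trans (mul_le_mul_of_nonneg_left ?_ hc)
      rw [h1]
      exact (truncNorm_sum_le _ _ _).trans (Finset.sum_le_sum fun r _ => hb' i r k _)
    calc truncNorm k (d i) ^ 2 ≤ (c * ∑ r, b i r * truncNorm k (f r)) ^ 2 :=
          pow_le_pow_left₀ (truncNorm_nonneg _ _) h5 2
      _ = c ^ 2 * (∑ r, b i r * truncNorm k (f r)) ^ 2 := by ring
      _ ≤ c ^ 2 * ((∑ r, b i r ^ 2) * ∑ r, truncNorm k (f r) ^ 2) := by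
          gcongr
          exact Finset.sum_mul_sq_le_sq_mul_sq _ _ _
      _ = _ := by ring
  refine ⟨∑ i, c ^ 2 * ∑ r, b i r ^ 2, by positivity, fun k d => ?_⟩
  rw [Finset.sum_mul]
  exact Finset.sum_le_sum fun i _ => key k d i

end truncNorm

/-! ### Detectability as an energy bound -/

/-- The squared Euclidean norm. -/
def normSq {d : ℕ} (z : Fin d → ℝ) : ℝ := z ⬝ᵥ z

lemma normSq_eq_sum {d : ℕ} (z : Fin d → ℝ) : normSq z = ∑ i, z i ^ 2 := by
  simp [normSq, dotProduct, sq]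

namespace DescriptorSystem

variable {n n₁ m q : ℕ}

/-- The matrix pencil `[E - X A; H]`. -/
def pencil (S : DescriptorSystem n n₁ m q) : Matrix (Fin n₁ ⊕ Fin m) (Fin n) (Polynomial ℂ) :=
  Matrix.fromRows
    (Matrix.of fun i j => Polynomial.C (S.E i j : ℂ) - Polynomial.X * Polynomial.C (S.A i j : ℂ))
    (Matrix.of fun i j => Polynomial.C (S.H i j : ℂ))

/-- This is detectability at `(μ, φ) = (1, z)`; the indeterminate plays the role of a delay by one
time step. -/
lemma Detectable.rank_pencil {S : DescriptorSystem n n₁ m q} (h : S.Detectable) (z : ℂ)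
    (hz : ‖z‖ ≤ 1) : (S.pencil.map (Polynomial.eval z)).rank = Fintype.card (Fin n) := by
  refine Eq.trans ?_ ((h 1 z (by simp) (by simpa using hz)).trans (Fintype.card_fin n).symm)
  congr 1
  ext i j
  rcases i with i | i
  · simp [pencil, complexify, mul_comm z, -Polynomial.X_mul_C]
  · simp [pencil, complexify]

/-- Detectability in quantitative form: the energy of a state sequence is bounded by the energy of
the initial data, the equation residuals and the outputs. -/
theorem Detectable.exists_energy_bound {S : DescriptorSystem n n₁ m q} (h : S.Detectable) :
    ∃ c : ℝ, 0 ≤ c ∧ ∀ (d : ℕ → Fin n → ℝ) (k : ℕ),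
      ∑ j ∈ Finset.range (k + 1), normSq (d j) ≤
        c * (normSq (S.E *ᵥ d 0) + normSq (S.H *ᵥ d 0) +
          ∑ j ∈ Finset.range k, (normSq (S.E *ᵥ d (j + 1) - S.A *ᵥ d j) +
            normSq (S.H *ᵥ d (j + 1)))) := by
  obtain ⟨c, hc, hb⟩ := exists_sum_truncNorm_sq_le S.pencil h.rank_pencil
  refine ⟨c, hc, fun d k => ?_⟩
  -- Generating functions of the components of `d`: in the `E` rows of the pencil, coefficient `0`
  -- is `E d 0` and coefficient `j + 1` is the residual `E d (j+1) - A d j`.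
  have key := hb k fun i => PowerSeries.mk fun j => (d j i : ℂ)
  convert key using 1
  · simp only [truncNorm_sq, PowerSeries.coeff_mk]
    rw [Finset.sum_comm]
    simp [normSq_eq_sum]
  · congr 1
    rw [Fintype.sum_sum_type]
    have hE0 : ∀ i, PowerSeries.coeff 0 ((S.pencil.map (fun p => (p : PowerSeries ℂ)) *ᵥ
        fun i => PowerSeries.mk fun j => (d j i : ℂ)) (Sum.inl i)) = ((S.E *ᵥ d 0) i : ℝ) := by
      intro i
      simp [pencil, Matrix.mulVec, dotProduct, sub_mul, mul_assoc]
    have hE1 : ∀ i k, PowerSeries.coeff (k + 1) ((S.pencil.map (fun p => (p : PowerSeries ℂ)) *ᵥ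
        fun i => PowerSeries.mk fun j => (d j i : ℂ)) (Sum.inl i)) =
          ((S.E *ᵥ d (k + 1) - S.A *ᵥ d k) i : ℝ) := by
      intro i k
      simp [pencil, Matrix.mulVec, dotProduct, sub_mul, mul_assoc, PowerSeries.coeff_succ_X_mul]
    have hH : ∀ i k, PowerSeries.coeff k ((S.pencil.map (fun p => (p : PowerSeries ℂ)) *ᵥ
        fun i => PowerSeries.mk fun j => (d j i : ℂ)) (Sum.inr i)) = ((S.H *ᵥ d k) i : ℝ) := by
      intro i k
      simp [pencil, Matrix.mulVec, dotProduct]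
    simp only [truncNorm_sq, Finset.sum_range_succ', hE0, hE1, hH, Finset.sum_add_distrib,
      normSq_eq_sum, Complex.norm_real, Real.norm_eq_abs, sq_abs]
    rw [Finset.sum_comm, Finset.sum_comm (s := Finset.range k)
      (f := fun j i => (S.H *ᵥ d (j + 1)) i ^ 2)]
    ring

end DescriptorSystem

/-! ### Weighted and Euclidean quadratic forms -/

section QuadraticForms

variable {d d' : ℕ}

lemma normSq_nonneg (z : Fin d → ℝ) : 0 ≤ normSq z := by
  rw [normSq_eq_sum]; positivity

lemma normSq_neg (z : Fin d → ℝ) : normSq (-z) = normSq z := by simp [normSq]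

lemma normSq_eq_zero {z : Fin d → ℝ} : normSq z = 0 ↔ z = 0 := dotProduct_self_eq_zero

lemma euclNorm_sq (z : Fin d → ℝ) : euclNorm z ^ 2 = normSq z := by
  rw [euclNorm, EuclideanSpace.norm_sq_eq, normSq_eq_sum]
  simp

lemma euclNorm_eq_sqrt (z : Fin d → ℝ) : euclNorm z = √(normSq z) := by
  rw [← euclNorm_sq, Real.sqrt_sq (by exact norm_nonneg _)]

lemma normSq_add_le (a b : Fin d → ℝ) : normSq (a + b) ≤ 2 * normSq a + 2 * normSq b := by
  simp only [normSq_eq_sum, Finset.mul_sum, ← Finset.sum_add_distrib, Pi.add_apply]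
  exact Finset.sum_le_sum fun i _ => by nlinarith [sq_nonneg (a i - b i)]

lemma exists_normSq_mulVec_le (M : Matrix (Fin d') (Fin d) ℝ) :
    ∃ c : ℝ, 0 ≤ c ∧ ∀ z, normSq (M *ᵥ z) ≤ c * normSq z := by
  refine ⟨∑ i, ∑ j, M i j ^ 2, by positivity, fun z => ?_⟩
  simp only [normSq_eq_sum]
  rw [Finset.sum_mul]
  exact Finset.sum_le_sum fun i _ => Finset.sum_mul_sq_le_sq_mul_sq Finset.univ (M i) z

lemma exists_dotProduct_mulVec_le (M : Matrix (Fin d) (Fin d) ℝ) :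
    ∃ c : ℝ, 0 ≤ c ∧ ∀ z, z ⬝ᵥ (M *ᵥ z) ≤ c * normSq z := by
  obtain ⟨c, hc, h⟩ := exists_normSq_mulVec_le M
  refine ⟨(1 + c) / 2, by positivity, fun z => ?_⟩
  have h1 : z ⬝ᵥ (M *ᵥ z) ≤ (normSq z + normSq (M *ᵥ z)) / 2 := by
    simp only [normSq_eq_sum, dotProduct, ← Finset.sum_add_distrib, Finset.sum_div]
    exact Finset.sum_le_sum fun i _ => by nlinarith [sq_nonneg (z i - (M *ᵥ z) i)]
  linarith [h z]

lemma dotProduct_mulVec_comm {M : Matrix (Fin d) (Fin d) ℝ} (hM : M.IsHermitian)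
    (a b : Fin d → ℝ) : a ⬝ᵥ (M *ᵥ b) = b ⬝ᵥ (M *ᵥ a) := by
  have hT : Mᵀ = M := by simpa [Matrix.IsHermitian] using hM
  rw [dotProduct_comm, Matrix.dotProduct_mulVec b, ← Matrix.mulVec_transpose, hT]

lemma weightedSq_add_add_weightedSq_sub (M : Matrix (Fin d) (Fin d) ℝ) (a b : Fin d → ℝ) :
    weightedSq M (a + b) + weightedSq M (a - b) = 2 * weightedSq M a + 2 * weightedSq M b := by
  simp only [weightedSq, Matrix.mulVec_add, Matrix.mulVec_sub, dotProduct_add, dotProduct_sub,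
    add_dotProduct, sub_dotProduct]
  ring

lemma weightedSq_smul (M : Matrix (Fin d) (Fin d) ℝ) (t : ℝ) (a : Fin d → ℝ) :
    weightedSq M (t • a) = t ^ 2 * weightedSq M a := by
  simp only [weightedSq, Matrix.mulVec_smul, dotProduct_smul, smul_dotProduct, smul_eq_mul]
  ring

lemma weightedSq_neg (M : Matrix (Fin d) (Fin d) ℝ) (a : Fin d → ℝ) :
    weightedSq M (-a) = weightedSq M a := by
  simp [weightedSq, Matrix.mulVec_neg]

lemma weightedSq_zero (M : Matrix (Fin d) (Fin d) ℝ) : weightedSq M 0 = 0 := by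
  simp [weightedSq]

variable {M : Matrix (Fin d) (Fin d) ℝ}

lemma weightedSq_nonneg (hM : M.PosDef) (z : Fin d → ℝ) : 0 ≤ weightedSq M z := by
  simpa [weightedSq] using hM.inv.posSemidef.dotProduct_mulVec_nonneg z

lemma weightedSq_sub (hM : M.PosDef) (a b : Fin d → ℝ) :
    weightedSq M (a - b) = weightedSq M a - 2 * (a ⬝ᵥ (M⁻¹ *ᵥ b)) + weightedSq M b := by
  simp only [weightedSq, Matrix.mulVec_sub, dotProduct_sub, sub_dotProduct]
  rw [dotProduct_mulVec_comm hM.inv.isHermitian b a]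
  ring

lemma inv_mulVec_mulVec (hM : M.PosDef) (z : Fin d → ℝ) : M⁻¹ *ᵥ (M *ᵥ z) = z := by
  rw [Matrix.mulVec_mulVec, Matrix.nonsing_inv_mul _ ((Matrix.isUnit_iff_isUnit_det _).mp hM.isUnit),
    Matrix.one_mulVec]

lemma mulVec_inv_mulVec (hM : M.PosDef) (z : Fin d → ℝ) : M *ᵥ (M⁻¹ *ᵥ z) = z := by
  rw [Matrix.mulVec_mulVec, Matrix.mul_nonsing_inv _ ((Matrix.isUnit_iff_isUnit_det _).mp hM.isUnit),
    Matrix.one_mulVec]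

lemma weightedSq_mulVec (hM : M.PosDef) (z : Fin d → ℝ) :
    weightedSq M (M *ᵥ z) = z ⬝ᵥ (M *ᵥ z) := by
  rw [weightedSq, inv_mulVec_mulVec hM, dotProduct_comm]

lemma weightedSq_sub_mulVec (hM : M.PosDef) (a z : Fin d → ℝ) :
    weightedSq M (a - M *ᵥ z) = weightedSq M a - 2 * (a ⬝ᵥ z) + z ⬝ᵥ (M *ᵥ z) := by
  rw [weightedSq_sub hM, inv_mulVec_mulVec hM, weightedSq_mulVec hM]

lemma exists_weightedSq_le (M : Matrix (Fin d) (Fin d) ℝ) :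
    ∃ c : ℝ, 0 ≤ c ∧ ∀ z, weightedSq M z ≤ c * normSq z := exists_dotProduct_mulVec_le M⁻¹

/-- Expanding `0 ≤ weightedSq M (z - t M z)` gives `2t‖z‖² - t² zᵀMz ≤ weightedSq M z`; the choice
`t = 1/(1+c)`, with `c` bounding the form of `M`, makes the left side at least `t‖z‖²`. -/
lemma exists_normSq_le (hM : M.PosDef) :
    ∃ c : ℝ, 0 ≤ c ∧ ∀ z, normSq z ≤ c * weightedSq M z := by
  obtain ⟨c, hc, h⟩ := exists_dotProduct_mulVec_le M
  refine ⟨1 + c, by positivity, fun z => ?_⟩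
  set t : ℝ := (1 + c)⁻¹ with ht
  have ht0 : 0 < t := by positivity
  have htc : (1 + c) * t = 1 := mul_inv_cancel₀ (by positivity)
  have h1 := weightedSq_nonneg hM (z - M *ᵥ (t • z))
  rw [weightedSq_sub_mulVec hM, Matrix.mulVec_smul, dotProduct_smul, dotProduct_smul,
    smul_dotProduct] at h1
  simp only [smul_eq_mul] at h1
  change 0 ≤ weightedSq M z - 2 * (t * normSq z) + t * (t * (z ⬝ᵥ M *ᵥ z)) at h1
  have h2 : t * (t * (z ⬝ᵥ M *ᵥ z)) ≤ t * (t * (c * normSq z)) := by gcongr; exact h z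
  have h3 : t * (t * (c * normSq z)) ≤ t * normSq z := by
    have : t * c ≤ 1 := by nlinarith
    have h4 := normSq_nonneg z
    calc t * (t * (c * normSq z)) = t * ((t * c) * normSq z) := by ring
      _ ≤ t * (1 * normSq z) := by gcongr
      _ = _ := by ring
  have h5 : t * normSq z ≤ weightedSq M z := by linarith
  calc normSq z = (1 + c) * (t * normSq z) := by rw [← mul_assoc, htc, one_mul]
    _ ≤ _ := by gcongr

end QuadraticForms

/-! ### Variational identities for the filter updates -/

section Riccati

variable {n n₁ m : ℕ} {A E : Matrix (Fin n₁) (Fin n) ℝ} {H : Matrix (Fin m) (Fin n) ℝ}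
  {P P' : Matrix (Fin n) (Fin n) ℝ} {Q W : Matrix (Fin n₁) (Fin n₁) ℝ}
  {R : Matrix (Fin m) (Fin m) ℝ}

lemma posDef_prediction (hP : P.PosDef) (hQ : Q.PosDef) : (A * P * Aᵀ + Q).PosDef := by
  have := hP.posSemidef.mul_mul_conjTranspose_same A
  rw [Matrix.conjTranspose_eq_transpose_of_trivial] at this
  exact Matrix.PosDef.posSemidef_add this hQ

lemma dotProduct_prediction (A : Matrix (Fin n₁) (Fin n) ℝ) (P : Matrix (Fin n) (Fin n) ℝ)
    (Q : Matrix (Fin n₁) (Fin n₁) ℝ) (z : Fin n₁ → ℝ) :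
    z ⬝ᵥ ((A * P * Aᵀ + Q) *ᵥ z) = (Aᵀ *ᵥ z) ⬝ᵥ (P *ᵥ (Aᵀ *ᵥ z)) + z ⬝ᵥ (Q *ᵥ z) := by
  rw [Matrix.add_mulVec, dotProduct_add, ← Matrix.mulVec_mulVec, ← Matrix.mulVec_mulVec,
    Matrix.dotProduct_mulVec z A, Matrix.mulVec_transpose]

/-- The weight of a predicted state splits into the weights of a previous state and of a
disturbance. -/
lemma weightedSq_prediction_eq (hP : P.PosDef) (hQ : Q.PosDef) (a : Fin n₁ → ℝ) :
    ∃ e, weightedSq (A * P * Aᵀ + Q) a = weightedSq P e + weightedSq Q (a - A *ᵥ e) := by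
  have hW := posDef_prediction (A := A) hP hQ
  set W := A * P * Aᵀ + Q with hWdef
  set z := W⁻¹ *ᵥ a with hz
  have ha : a = W *ᵥ z := (mulVec_inv_mulVec hW a).symm
  -- The minimizer of `weightedSq P e + weightedSq Q (a - A e)`; the disturbance left over is `Q z`.
  refine ⟨P *ᵥ (Aᵀ *ᵥ z), ?_⟩
  have h1 : a - A *ᵥ (P *ᵥ (Aᵀ *ᵥ z)) = Q *ᵥ z := by
    rw [ha, hWdef, Matrix.add_mulVec, ← Matrix.mulVec_mulVec, ← Matrix.mulVec_mulVec,
      add_sub_cancel_left]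
  rw [h1, weightedSq_mulVec hP, weightedSq_mulVec hQ, ha, weightedSq_mulVec hW, hWdef,
    dotProduct_prediction]

/-- The minimality half of the prediction identity: add the nonnegative weights of the deviations `e
- P Aᵀ z` and `w - Q z` from the optimal splitting. -/
lemma weightedSq_prediction_le (hP : P.PosDef) (hQ : Q.PosDef) (e : Fin n → ℝ) (w : Fin n₁ → ℝ) :
    weightedSq (A * P * Aᵀ + Q) (A *ᵥ e + w) ≤ weightedSq P e + weightedSq Q w := by
  have hW := posDef_prediction (A := A) hP hQ
  set W := A * P * Aᵀ + Q with hWdef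
  set z := W⁻¹ *ᵥ (A *ᵥ e + w) with hz
  have ha : A *ᵥ e + w = W *ᵥ z := (mulVec_inv_mulVec hW _).symm
  have h1 := weightedSq_nonneg hP (e - P *ᵥ (Aᵀ *ᵥ z))
  have h2 := weightedSq_nonneg hQ (w - Q *ᵥ z)
  rw [weightedSq_sub_mulVec hP] at h1
  rw [weightedSq_sub_mulVec hQ] at h2
  have h3 : z ⬝ᵥ (W *ᵥ z) = e ⬝ᵥ (Aᵀ *ᵥ z) + w ⬝ᵥ z := by
    rw [← ha, dotProduct_add, Matrix.dotProduct_mulVec, ← Matrix.mulVec_transpose,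
      dotProduct_comm, dotProduct_comm z w]
  have h4 := dotProduct_prediction A P Q z
  rw [← hWdef] at h4
  rw [ha, weightedSq_mulVec hW]
  linarith

lemma posDef_information (hW : W.PosDef) (hR : R.PosDef)
    (hEH : ∀ z, E *ᵥ z = 0 → H *ᵥ z = 0 → z = 0) : (Eᵀ * W⁻¹ * E + Hᵀ * R⁻¹ * H).PosDef := by
  have h1 := hW.inv.posSemidef.conjTranspose_mul_mul_same E
  have h2 := hR.inv.posSemidef.conjTranspose_mul_mul_same H
  rw [Matrix.conjTranspose_eq_transpose_of_trivial] at h1 h2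
  refine Matrix.PosDef.of_dotProduct_mulVec_pos (h1.add h2).isHermitian fun z hz => ?_
  have h3 : star z ⬝ᵥ ((Eᵀ * W⁻¹ * E + Hᵀ * R⁻¹ * H) *ᵥ z) =
      (E *ᵥ z) ⬝ᵥ (W⁻¹ *ᵥ (E *ᵥ z)) + (H *ᵥ z) ⬝ᵥ (R⁻¹ *ᵥ (H *ᵥ z)) := by
    simp only [star_trivial, Matrix.add_mulVec, dotProduct_add, ← Matrix.mulVec_mulVec,
      Matrix.dotProduct_mulVec z, Matrix.vecMul_transpose]
  rw [h3]
  have h4 := weightedSq_nonneg hW (E *ᵥ z)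
  have h5 := weightedSq_nonneg hR (H *ᵥ z)
  by_cases hE : E *ᵥ z = 0
  · have hH : H *ᵥ z ≠ 0 := fun hH => hz (hEH z hE hH)
    exact add_pos_of_nonneg_of_pos h4 (by simpa using hR.inv.dotProduct_mulVec_pos hH)
  · exact add_pos_of_pos_of_nonneg (by simpa using hW.inv.dotProduct_mulVec_pos hE) h5

lemma weightedSq_update_eq (hF : (Eᵀ * W⁻¹ * E + Hᵀ * R⁻¹ * H).PosDef) (z : Fin n → ℝ) :
    weightedSq (Eᵀ * W⁻¹ * E + Hᵀ * R⁻¹ * H)⁻¹ z =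
      weightedSq W (E *ᵥ z) + weightedSq R (H *ᵥ z) := by
  rw [weightedSq, Matrix.nonsing_inv_nonsing_inv _
    ((Matrix.isUnit_iff_isUnit_det _).mp hF.isUnit)]
  simp only [weightedSq, Matrix.add_mulVec, dotProduct_add, ← Matrix.mulVec_mulVec,
      Matrix.dotProduct_mulVec z, Matrix.vecMul_transpose]

/-- Energy balance of the measurement update of an estimation error. -/
lemma weightedSq_update_balance (hW : W.PosDef)
    (hF : (Eᵀ * W⁻¹ * E + Hᵀ * R⁻¹ * H).PosDef) (a : Fin n₁ → ℝ) (e : Fin n → ℝ)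
    (he : e = (Eᵀ * W⁻¹ * E + Hᵀ * R⁻¹ * H)⁻¹ *ᵥ (Eᵀ *ᵥ (W⁻¹ *ᵥ a))) :
    weightedSq (Eᵀ * W⁻¹ * E + Hᵀ * R⁻¹ * H)⁻¹ e + weightedSq W (E *ᵥ e - a) +
      weightedSq R (H *ᵥ e) = weightedSq W a := by
  have h1 : weightedSq (Eᵀ * W⁻¹ * E + Hᵀ * R⁻¹ * H)⁻¹ e = (E *ᵥ e) ⬝ᵥ (W⁻¹ *ᵥ a) := by
    rw [weightedSq]
    -- `he` is the normal equation `F e = Eᵀ W⁻¹ a` for the information matrix `F`; it is used on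
    -- one of the two copies of `e` only.
    conv_lhs => rw [he, inv_mulVec_mulVec hF.inv, ← he]
    rw [Matrix.dotProduct_mulVec, Matrix.vecMul_transpose]
  have h2 := weightedSq_update_eq hF e
  rw [weightedSq_sub hW]
  linarith

end Riccati

/-- The energy bound at length `k = 0`. It makes the information matrices positive definite. -/
lemma DescriptorSystem.Detectable.eq_zero {n n₁ m q : ℕ} {S : DescriptorSystem n n₁ m q}
    (h : S.Detectable) (z : Fin n → ℝ) (hE : S.E *ᵥ z = 0) (hH : S.H *ᵥ z = 0) : z = 0 := by
  obtain ⟨c, -, hc⟩ := h.exists_energy_bound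
  have h1 := hc (fun _ => z) 0
  simp only [zero_add, Finset.range_one, Finset.sum_singleton, Finset.range_zero,
    Finset.sum_empty, hE, hH] at h1
  rw [normSq_eq_zero.mpr rfl, normSq_eq_zero.mpr rfl] at h1
  exact normSq_eq_zero.mp (le_antisymm (by linarith) (normSq_nonneg z))

/-! ### Uniform bounds on the filter covariances -/

namespace Estimator

variable {n n₁ m q : ℕ} {S : Estimator n n₁ m q}

/-- The standing assumptions on the weights and the system. -/
structure IsRegular (S : Estimator n n₁ m q) : Prop where
  posDef_Q : S.Q.PosDef
  posDef_R : S.R.PosDef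
  posDef_P₀ : S.P₀.PosDef
  detectable : S.toDescriptorSystem.Detectable

lemma IsRegular.posDef_covPlus (h : S.IsRegular) (k : ℕ) : (S.covPlus k).PosDef := by
  induction k with
  | zero => exact h.posDef_P₀
  | succ k ih =>
    exact (posDef_information (posDef_prediction ih h.posDef_Q) h.posDef_R h.detectable.eq_zero).inv

lemma IsRegular.posDef_covMinus (h : S.IsRegular) (k : ℕ) : (S.covMinus k).PosDef :=
  posDef_prediction (h.posDef_covPlus k) h.posDef_Q

lemma IsRegular.posDef_information (h : S.IsRegular) (k : ℕ) :
    (S.Eᵀ * (S.covMinus k)⁻¹ * S.E + S.Hᵀ * S.R⁻¹ * S.H).PosDef :=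
  DescriptorMHE.posDef_information (h.posDef_covMinus k) h.posDef_R h.detectable.eq_zero

lemma covPlus_succ (S : Estimator n n₁ m q) (k : ℕ) : S.covPlus (k + 1) =
    (S.Eᵀ * (S.covMinus k)⁻¹ * S.E + S.Hᵀ * S.R⁻¹ * S.H)⁻¹ := rfl

/-- The weight of a filter covariance is the cost of some state sequence. -/
lemma IsRegular.exists_sequence (h : S.IsRegular) (k : ℕ) (z : Fin n → ℝ) :
    ∃ d : ℕ → Fin n → ℝ, d k = z ∧ weightedSq (S.covPlus k) z = weightedSq S.P₀ (d 0) +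
      ∑ j ∈ Finset.range k, (weightedSq S.Q (S.E *ᵥ d (j + 1) - S.A *ᵥ d j) +
        weightedSq S.R (S.H *ᵥ d (j + 1))) := by
  induction k generalizing z with
  | zero => exact ⟨fun _ => z, rfl, by simp [covPlus]⟩
  | succ k ih =>
    obtain ⟨e, he⟩ := weightedSq_prediction_eq (A := S.A) (h.posDef_covPlus k) h.posDef_Q (S.E *ᵥ z)
    obtain ⟨d, hdk, hd⟩ := ih e
    -- The optimal predecessor `e` of `z` ends the sequence given by induction; `z` is appended at
    -- time `k + 1`.
    refine ⟨fun j => if j ≤ k then d j else z, by simp, ?_⟩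
    rw [covPlus_succ, weightedSq_update_eq (h.posDef_information k), Finset.sum_range_succ]
    have h1 : ∑ j ∈ Finset.range k, (weightedSq S.Q (S.E *ᵥ (if j + 1 ≤ k then d (j + 1) else z) -
        S.A *ᵥ (if j ≤ k then d j else z)) +
        weightedSq S.R (S.H *ᵥ (if j + 1 ≤ k then d (j + 1) else z))) =
        ∑ j ∈ Finset.range k, (weightedSq S.Q (S.E *ᵥ d (j + 1) - S.A *ᵥ d j) +
        weightedSq S.R (S.H *ᵥ d (j + 1))) := by
      refine Finset.sum_congr rfl fun j hj => ?_
      have hj' := Finset.mem_range.mp hj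
      rw [if_pos (by omega), if_pos (by omega)]
    rw [h1]
    simp only [Nat.zero_le, if_true, le_refl, hdk]
    rw [if_neg (by omega)]
    change weightedSq (S.A * S.covPlus k * S.Aᵀ + S.Q) _ + _ = _
    rw [he, hd]
    ring

/-- The filter covariances are uniformly bounded. -/
lemma IsRegular.exists_normSq_le_covPlus (h : S.IsRegular) :
    ∃ c : ℝ, 0 ≤ c ∧ ∀ k z, normSq z ≤ c * weightedSq (S.covPlus k) z := by
  obtain ⟨c, hc, hb⟩ := h.detectable.exists_energy_bound
  obtain ⟨cE, hcE, hE⟩ := exists_normSq_mulVec_le S.E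
  obtain ⟨cH, hcH, hH⟩ := exists_normSq_mulVec_le S.H
  obtain ⟨cP, hcP, hP⟩ := exists_normSq_le h.posDef_P₀
  obtain ⟨cQ, hcQ, hQ⟩ := exists_normSq_le h.posDef_Q
  obtain ⟨cR, hcR, hR⟩ := exists_normSq_le h.posDef_R
  -- `(cE + cH) * cP` pays for the initial terms `E d 0` and `H d 0`, and `cQ`, `cR` for the
  -- residuals and outputs.
  refine ⟨c * ((cE + cH) * cP + cQ + cR), by positivity, fun k z => ?_⟩
  obtain ⟨d, rfl, hd⟩ := h.exists_sequence k z
  have h0 := weightedSq_nonneg h.posDef_P₀ (d 0)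
  have hQ0 := fun w => weightedSq_nonneg h.posDef_Q w
  have hR0 := fun w => weightedSq_nonneg h.posDef_R w
  calc normSq (d k) ≤ ∑ j ∈ Finset.range (k + 1), normSq (d j) :=
        Finset.single_le_sum (f := fun j => normSq (d j)) (fun j _ => normSq_nonneg _) (by simp)
    _ ≤ _ := hb d k
    _ ≤ c * (((cE + cH) * cP + cQ + cR) * weightedSq (S.covPlus k) (d k)) := by
        gcongr
        rw [hd, mul_add, Finset.mul_sum]
        refine add_le_add ?_ (Finset.sum_le_sum fun j _ => ?_)
        · have h1 := hE (d 0)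
          have h2 := hH (d 0)
          have h3 : (cE + cH) * normSq (d 0) ≤ (cE + cH) * (cP * weightedSq S.P₀ (d 0)) := by
            gcongr; exact hP _
          have h4 : 0 ≤ (cQ + cR) * weightedSq S.P₀ (d 0) := by positivity
          linarith
        · have h1 := hQ (S.E *ᵥ d (j + 1) - S.A *ᵥ d j)
          have h2 := hR (S.H *ᵥ d (j + 1))
          have h3 := hQ0 (S.E *ᵥ d (j + 1) - S.A *ᵥ d j)
          have h4 := hR0 (S.H *ᵥ d (j + 1))
          set α := weightedSq S.Q (S.E *ᵥ d (j + 1) - S.A *ᵥ d j)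
          set β := weightedSq S.R (S.H *ᵥ d (j + 1))
          have h5 : 0 ≤ (cE + cH) * cP * (α + β) := by positivity
          have h6 : 0 ≤ cR * α + cQ * β := by positivity
          linarith
    _ = _ := by ring

/-- The predicted covariances are uniformly bounded. -/
lemma IsRegular.exists_normSq_le_covMinus (h : S.IsRegular) :
    ∃ c : ℝ, 0 ≤ c ∧ ∀ k a, normSq a ≤ c * weightedSq (S.covMinus k) a := by
  obtain ⟨c, hc, hb⟩ := h.exists_normSq_le_covPlus
  obtain ⟨cA, hcA, hA⟩ := exists_normSq_mulVec_le S.A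
  obtain ⟨cQ, hcQ, hQ⟩ := exists_normSq_le h.posDef_Q
  refine ⟨2 * (cA * c) + 2 * cQ, by positivity, fun k a => ?_⟩
  obtain ⟨e, he⟩ := weightedSq_prediction_eq (A := S.A) (h.posDef_covPlus k) h.posDef_Q a
  have h1 := normSq_add_le (S.A *ᵥ e) (a - S.A *ᵥ e)
  rw [add_sub_cancel] at h1
  have h2 : normSq (S.A *ᵥ e) ≤ cA * (c * weightedSq (S.covPlus k) e) :=
    (hA e).trans (by gcongr; exact hb k e)
  have h3 := hQ (a - S.A *ᵥ e)
  have h4 := weightedSq_nonneg (h.posDef_covPlus k) e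
  have h5 := weightedSq_nonneg h.posDef_Q (a - S.A *ᵥ e)
  have h6 : 0 ≤ cQ * weightedSq (S.covPlus k) e := by positivity
  have h7 : 0 ≤ cA * c * weightedSq S.Q (a - S.A *ᵥ e) := by positivity
  change _ ≤ _ * weightedSq (S.A * S.covPlus k * S.Aᵀ + S.Q) a
  rw [he]
  linarith

/-- Since `P⁻ ≥ Q`, inverses are ordered the other way; no lower bound on `covPlus` is needed. -/
lemma IsRegular.weightedSq_covMinus_le (h : S.IsRegular) (k : ℕ) (a : Fin n₁ → ℝ) :
    weightedSq (S.covMinus k) a ≤ weightedSq S.Q a := by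
  have := weightedSq_prediction_le (A := S.A) (h.posDef_covPlus k) h.posDef_Q 0 a
  simpa [weightedSq_zero, covMinus] using this

/-! ### Convergence of the unconstrained filter -/

section Kalman

variable {u : ℕ → Fin q → ℝ} {y : ℕ → Fin m → ℝ} {x : ℕ → Fin n → ℝ}

/-- The error of the unconstrained filter. -/
def kalmanError (S : Estimator n n₁ m q) (u : ℕ → Fin q → ℝ) (y : ℕ → Fin m → ℝ)
    (x : ℕ → Fin n → ℝ) (xbar : Fin n → ℝ) (k : ℕ) : Fin n → ℝ :=
  S.kalman u y xbar k - x k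

/-- The weight of the predicted error of the unconstrained filter. -/
def predictedWeight (S : Estimator n n₁ m q) (u : ℕ → Fin q → ℝ) (y : ℕ → Fin m → ℝ)
    (x : ℕ → Fin n → ℝ) (xbar : Fin n → ℝ) (k : ℕ) : ℝ :=
  weightedSq (S.covMinus k) (S.A *ᵥ S.kalmanError u y x xbar k)

/-- Without noise the true state is reproduced by the update with exact prediction, because `F x =
Eᵀ W⁻¹ (E x) + Hᵀ R⁻¹ (H x)`. By linearity only the propagated error remains. -/
lemma IsRegular.kalmanError_succ (h : S.IsRegular) (hx : S.IsTrueTrajectory u y x)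
    (xbar : Fin n → ℝ) (k : ℕ) : S.kalmanError u y x xbar (k + 1) =
      (S.Eᵀ * (S.covMinus k)⁻¹ * S.E + S.Hᵀ * S.R⁻¹ * S.H)⁻¹ *ᵥ
        (S.Eᵀ *ᵥ ((S.covMinus k)⁻¹ *ᵥ (S.A *ᵥ S.kalmanError u y x xbar k))) := by
  have h1 : S.A *ᵥ S.kalman u y xbar k + S.B *ᵥ u k =
      S.A *ᵥ S.kalmanError u y x xbar k + S.E *ᵥ x (k + 1) := by
    rw [hx.1 k, kalmanError, Matrix.mulVec_sub]
    abel
  have h2 := inv_mulVec_mulVec (h.posDef_information k) (x (k + 1))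
  rw [kalmanError, kalman, h1, hx.2.1 k, covPlus_succ]
  simp only [← Matrix.mulVec_mulVec, Matrix.add_mulVec, Matrix.mulVec_add] at h2 ⊢
  rw [sub_eq_iff_eq_add]
  refine Eq.trans ?_ (congrArg (_ + ·) h2)
  abel

/-- The Lyapunov step: the update dissipates exactly the weighted residual and output of the error.
-/
lemma IsRegular.kalmanError_balance (h : S.IsRegular) (hx : S.IsTrueTrajectory u y x)
    (xbar : Fin n → ℝ) (k : ℕ) :
    weightedSq (S.covPlus (k + 1)) (S.kalmanError u y x xbar (k + 1)) +
      weightedSq (S.covMinus k)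
        (S.E *ᵥ S.kalmanError u y x xbar (k + 1) - S.A *ᵥ S.kalmanError u y x xbar k) +
      weightedSq S.R (S.H *ᵥ S.kalmanError u y x xbar (k + 1)) =
    S.predictedWeight u y x xbar k := by
  rw [covPlus_succ]
  exact weightedSq_update_balance (h.posDef_covMinus k) (h.posDef_information k) _ _
    (h.kalmanError_succ hx xbar k)

lemma IsRegular.predictedWeight_le (h : S.IsRegular) (xbar : Fin n → ℝ) (k : ℕ) :
    S.predictedWeight u y x xbar k ≤ weightedSq (S.covPlus k) (S.kalmanError u y x xbar k) := by
  have := weightedSq_prediction_le (A := S.A) (h.posDef_covPlus k) h.posDef_Q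
    (S.kalmanError u y x xbar k) 0
  simpa [weightedSq_zero, covMinus, predictedWeight] using this

lemma IsRegular.antitone_predictedWeight (h : S.IsRegular) (hx : S.IsTrueTrajectory u y x)
    (xbar : Fin n → ℝ) : Antitone (S.predictedWeight u y x xbar) := by
  refine antitone_nat_of_succ_le fun k => (h.predictedWeight_le xbar (k + 1)).trans ?_
  have h1 := h.kalmanError_balance hx xbar k
  have h2 := weightedSq_nonneg (h.posDef_covMinus k)
    (S.E *ᵥ S.kalmanError u y x xbar (k + 1) - S.A *ᵥ S.kalmanError u y x xbar k)
  have h3 := weightedSq_nonneg h.posDef_R (S.H *ᵥ S.kalmanError u y x xbar (k + 1))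
  linarith

/-- The balance telescopes, since prediction does not increase the weight. -/
lemma IsRegular.sum_residuals_le (h : S.IsRegular) (hx : S.IsTrueTrajectory u y x)
    (xbar : Fin n → ℝ) (k : ℕ) :
    weightedSq (S.covPlus k) (S.kalmanError u y x xbar k) + ∑ j ∈ Finset.range k,
      (weightedSq (S.covMinus j)
        (S.E *ᵥ S.kalmanError u y x xbar (j + 1) - S.A *ᵥ S.kalmanError u y x xbar j) +
      weightedSq S.R (S.H *ᵥ S.kalmanError u y x xbar (j + 1))) ≤
    weightedSq S.P₀ (S.kalmanError u y x xbar 0) := by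
  induction k with
  | zero => simp [covPlus]
  | succ k ih =>
    rw [Finset.sum_range_succ]
    linarith [h.kalmanError_balance hx xbar k, h.predictedWeight_le (u := u) (y := y) (x := x) xbar k]

/-- Bounded covariances turn the weighted residual sums into Euclidean ones, and the energy bound
passes from residuals to the errors with a constant independent of the length. -/
lemma IsRegular.summable_kalmanError (h : S.IsRegular) (hx : S.IsTrueTrajectory u y x)
    (xbar : Fin n → ℝ) : Summable fun k => normSq (S.kalmanError u y x xbar k) := by
  obtain ⟨c, hc, hb⟩ := h.detectable.exists_energy_bound
  obtain ⟨cW, hcW, hW⟩ := h.exists_normSq_le_covMinus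
  obtain ⟨cR, hcR, hR⟩ := exists_normSq_le h.posDef_R
  set e := S.kalmanError u y x xbar with he
  set K := c * (normSq (S.E *ᵥ e 0) + normSq (S.H *ᵥ e 0) + (cW + cR) * weightedSq S.P₀ (e 0))
  have hle : ∀ k, ∑ j ∈ Finset.range (k + 1), normSq (e j) ≤ K := by
    intro k
    refine (hb e k).trans (mul_le_mul_of_nonneg_left ?_ hc)
    have h1 := h.sum_residuals_le hx xbar k
    have h2 := weightedSq_nonneg (h.posDef_covPlus k) (e k)
    rw [← he] at h1
    refine add_le_add le_rfl ?_
    refine le_trans ?_ (mul_le_mul_of_nonneg_left (le_trans (le_add_of_nonneg_left h2) h1)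
      (by positivity))
    rw [Finset.mul_sum]
    refine Finset.sum_le_sum fun j _ => ?_
    have h3 := hW j (S.E *ᵥ e (j + 1) - S.A *ᵥ e j)
    have h4 := hR (S.H *ᵥ e (j + 1))
    have h5 := weightedSq_nonneg (h.posDef_covMinus j) (S.E *ᵥ e (j + 1) - S.A *ᵥ e j)
    have h6 := weightedSq_nonneg h.posDef_R (S.H *ᵥ e (j + 1))
    have h7 := mul_nonneg hcR h5
    have h8 := mul_nonneg hcW h6
    linarith
  refine summable_of_sum_range_le (c := K) (fun k => normSq_nonneg _) fun k => ?_
  refine le_trans ?_ (hle k)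
  exact Finset.sum_le_sum_of_subset_of_nonneg (Finset.range_mono (Nat.le_succ k))
    fun j _ _ => normSq_nonneg _

lemma IsRegular.tendsto_predictedWeight (h : S.IsRegular) (hx : S.IsTrueTrajectory u y x)
    (xbar : Fin n → ℝ) :
    Filter.Tendsto (S.predictedWeight u y x xbar) Filter.atTop (nhds 0) := by
  obtain ⟨cQ, hcQ, hQ⟩ := exists_weightedSq_le S.Q
  obtain ⟨cA, hcA, hA⟩ := exists_normSq_mulVec_le S.A
  have h1 := ((h.summable_kalmanError hx xbar).tendsto_atTop_zero).const_mul (cQ * cA)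
  rw [mul_zero] at h1
  refine squeeze_zero (fun k => weightedSq_nonneg (h.posDef_covMinus k) _) (fun k => ?_) h1
  refine (h.weightedSq_covMinus_le k _).trans ((hQ _).trans ?_)
  rw [mul_assoc]
  exact mul_le_mul_of_nonneg_left (hA _) hcQ

end Kalman

end Estimator

/-! ### Constraint sets and the energy of a window -/

lemma IsPolyhedral.isClosed {d : ℕ} {K : Set (Fin d → ℝ)} (hK : IsPolyhedral K) : IsClosed K := by
  obtain ⟨r, C, b, rfl⟩ := hK
  simp only [Set.ofPred_forall]
  refine isClosed_iInter fun i => isClosed_le ?_ continuous_const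
  exact (continuous_apply i).comp (Continuous.matrix_mulVec continuous_const continuous_id)

lemma IsPolyhedral.convex {d : ℕ} {K : Set (Fin d → ℝ)} (hK : IsPolyhedral K) : Convex ℝ K := by
  obtain ⟨r, C, b, rfl⟩ := hK
  intro x hx z hz s t hs ht hst i
  have h1 := mul_le_mul_of_nonneg_left (hx i) hs
  have h2 := mul_le_mul_of_nonneg_left (hz i) ht
  simp only [Matrix.mulVec_add, Matrix.mulVec_smul, Pi.add_apply, Pi.smul_apply, smul_eq_mul]
  calc _ ≤ s * b i + t * b i := add_le_add h1 h2
    _ = b i := by rw [← add_mul, hst, one_mul]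

lemma continuous_weightedSq {d : ℕ} (M : Matrix (Fin d) (Fin d) ℝ) : Continuous (weightedSq M) := by
  unfold weightedSq
  exact Continuous.dotProduct continuous_id (Continuous.matrix_mulVec continuous_const continuous_id)

namespace Estimator

variable {n n₁ m q : ℕ} {S : Estimator n n₁ m q}

lemma one_le_windowStart (S : Estimator n n₁ m q) (T : ℕ) : 1 ≤ S.windowStart T := le_max_left _ _

lemma windowStart_le (S : Estimator n n₁ m q) {T : ℕ} (hT : 1 ≤ T) : S.windowStart T ≤ T :=
  max_le hT (Nat.sub_le _ _)

/-- The objective of the window problem for the homogeneous system. -/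
def windowEnergy (S : Estimator n n₁ m q) (T : ℕ) (d : ℕ → Fin n → ℝ) : ℝ :=
  weightedSq (S.covMinus (S.windowStart T - 1)) (S.E *ᵥ d (S.windowStart T)) +
    ∑ k ∈ Finset.Ico (S.windowStart T) T, weightedSq S.Q (S.E *ᵥ d (k + 1) - S.A *ᵥ d k) +
    ∑ k ∈ Finset.Ico (S.windowStart T - 1) T, weightedSq S.R (S.H *ᵥ d (k + 1))

/-- The states in the window are bounded by the homogeneous objective, uniformly in time. -/
lemma IsRegular.exists_normSq_le_windowEnergy (h : S.IsRegular) :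
    ∃ c : ℝ, 0 ≤ c ∧ ∀ T, 1 ≤ T → ∀ (d : ℕ → Fin n → ℝ), ∀ k ∈ Finset.Icc (S.windowStart T) T,
      normSq (d k) ≤ c * S.windowEnergy T d := by
  obtain ⟨c, hc, hb⟩ := h.detectable.exists_energy_bound
  obtain ⟨cW, hcW, hW⟩ := h.exists_normSq_le_covMinus
  obtain ⟨cQ, hcQ, hQ⟩ := exists_normSq_le h.posDef_Q
  obtain ⟨cR, hcR, hR⟩ := exists_normSq_le h.posDef_R
  refine ⟨c * (cW + cQ + cR), by positivity, fun T hT d k hk => ?_⟩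
  obtain ⟨t, ht⟩ : ∃ t, S.windowStart T = t + 1 := ⟨S.windowStart T - 1, by
    have := S.one_le_windowStart T; omega⟩
  have hsT := S.windowStart_le hT
  rw [windowEnergy]
  rw [ht] at hk hsT ⊢
  rw [Finset.mem_Icc] at hk
  -- The noise sum starts one index before the window, at the output of `x_s`; splitting off that
  -- term supplies the initial output required by the energy bound.
  rw [Nat.add_sub_cancel, Finset.sum_eq_sum_Ico_succ_bot hsT,
    Finset.sum_Ico_eq_sum_range, Finset.sum_Ico_eq_sum_range]
  have h1 := hb (fun j => d (t + 1 + j)) (T - (t + 1))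
  have h2 : normSq (d k) ≤ ∑ j ∈ Finset.range (T - (t + 1) + 1), normSq (d (t + 1 + j)) := by
    have := Finset.single_le_sum (s := Finset.range (T - (t + 1) + 1))
      (f := fun j => normSq (d (t + 1 + j))) (fun j _ => normSq_nonneg _)
      (a := k - (t + 1)) (by rw [Finset.mem_range]; omega)
    simpa only [Nat.add_sub_cancel' hk.1] using this
  refine h2.trans (h1.trans ?_)
  rw [mul_assoc c]
  refine mul_le_mul_of_nonneg_left ?_ hc
  simp only [add_zero, ← add_assoc]
  rw [Finset.sum_add_distrib]
  have h3 := hW t (S.E *ᵥ d (t + 1))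
  have h4 := hR (S.H *ᵥ d (t + 1))
  have h5 : ∑ j ∈ Finset.range (T - (t + 1)),
      normSq (S.E *ᵥ d (t + 1 + j + 1) - S.A *ᵥ d (t + 1 + j)) ≤ cQ *
        ∑ j ∈ Finset.range (T - (t + 1)),
          weightedSq S.Q (S.E *ᵥ d (t + 1 + j + 1) - S.A *ᵥ d (t + 1 + j)) := by
    rw [Finset.mul_sum]
    exact Finset.sum_le_sum fun j _ => hQ _
  have h6 : ∑ j ∈ Finset.range (T - (t + 1)), normSq (S.H *ᵥ d (t + 1 + j + 1)) ≤ cR *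
        ∑ j ∈ Finset.range (T - (t + 1)), weightedSq S.R (S.H *ᵥ d (t + 1 + j + 1)) := by
    rw [Finset.mul_sum]
    exact Finset.sum_le_sum fun j _ => hR _
  have g1 := weightedSq_nonneg (h.posDef_covMinus t) (S.E *ᵥ d (t + 1))
  have g2 := weightedSq_nonneg h.posDef_R (S.H *ᵥ d (t + 1))
  have g3 : 0 ≤ ∑ j ∈ Finset.range (T - (t + 1)),
      weightedSq S.Q (S.E *ᵥ d (t + 1 + j + 1) - S.A *ᵥ d (t + 1 + j)) :=
    Finset.sum_nonneg fun j _ => weightedSq_nonneg h.posDef_Q _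
  have g4 : 0 ≤ ∑ j ∈ Finset.range (T - (t + 1)), weightedSq S.R (S.H *ᵥ d (t + 1 + j + 1)) :=
    Finset.sum_nonneg fun j _ => weightedSq_nonneg h.posDef_R _
  generalize weightedSq (S.covMinus t) (S.E *ᵥ d (t + 1)) = α at *
  generalize weightedSq S.R (S.H *ᵥ d (t + 1)) = β at *
  generalize ∑ j ∈ Finset.range (T - (t + 1)),
      weightedSq S.Q (S.E *ᵥ d (t + 1 + j + 1) - S.A *ᵥ d (t + 1 + j)) = γ at *
  generalize ∑ j ∈ Finset.range (T - (t + 1)),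
      weightedSq S.R (S.H *ᵥ d (t + 1 + j + 1)) = η at *
  have f1 : 0 ≤ cW * (γ + β + η) := by positivity
  have f2 : 0 ≤ cQ * (α + β + η) := by positivity
  have f3 : 0 ≤ cR * (α + γ) := by positivity
  linarith

/-! ### The window problem: parallelogram law and continuity -/

section Window

variable {u : ℕ → Fin q → ℝ} {y : ℕ → Fin m → ℝ} {x : ℕ → Fin n → ℝ} {xbar : Fin n → ℝ} {T : ℕ}

/-- The midpoint of two decisions. -/
def midpoint (ζ ζ' : Decision n n₁ m) : Decision n n₁ m where
  x k := (1 / 2 : ℝ) • ζ.x k + (1 / 2 : ℝ) • ζ'.x k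
  w k := (1 / 2 : ℝ) • ζ.w k + (1 / 2 : ℝ) • ζ'.w k
  v k := (1 / 2 : ℝ) • ζ.v k + (1 / 2 : ℝ) • ζ'.v k

lemma Feasible.midpoint (hX : Convex ℝ S.X) (hW : Convex ℝ S.W) (hV : Convex ℝ S.V)
    {ζ ζ' : Decision n n₁ m} (h : S.Feasible u y T ζ) (h' : S.Feasible u y T ζ') :
    S.Feasible u y T (midpoint ζ ζ') := by
  obtain ⟨h1, h2, h3, h4, h5⟩ := h
  obtain ⟨h1', h2', h3', h4', h5'⟩ := h'
  have half : (0 : ℝ) ≤ 1 / 2 := by norm_num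
  have one : (1 / 2 : ℝ) + 1 / 2 = 1 := by norm_num
  refine ⟨fun k hk => hX (h1 k hk) (h1' k hk) half half one,
    fun k hk => hW (h2 k hk) (h2' k hk) half half one,
    fun k hk => hV (h3 k hk) (h3' k hk) half half one, fun k hk => ?_, fun k hk => ?_⟩
  · have e : S.B *ᵥ u k = (1 / 2 : ℝ) • S.B *ᵥ u k + (1 / 2 : ℝ) • S.B *ᵥ u k := by
      rw [← add_smul, one, one_smul]
    simp only [Estimator.midpoint, Matrix.mulVec_add, Matrix.mulVec_smul, h4 k hk, h4' k hk,
      smul_add]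
    conv_rhs => rw [e]
    abel
  · have e : y (k + 1) = (1 / 2 : ℝ) • y (k + 1) + (1 / 2 : ℝ) • y (k + 1) := by
      rw [← add_smul, one, one_smul]
    rw [e]
    nth_rewrite 1 [h5 k hk]
    rw [h5' k hk]
    simp only [Estimator.midpoint, Matrix.mulVec_add, Matrix.mulVec_smul, smul_add]
    abel

/-- Both signs of the difference are allowed because `v = y - H x` reverses the sign of a state
difference. -/
lemma weightedSq_half_add {d : ℕ} (M : Matrix (Fin d) (Fin d) ℝ) (a b c : Fin d → ℝ)
    (hc : c = a - b ∨ c = b - a) :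
    4 * weightedSq M ((1 / 2 : ℝ) • a + (1 / 2 : ℝ) • b) + weightedSq M c =
      2 * weightedSq M a + 2 * weightedSq M b := by
  rw [← smul_add, weightedSq_smul, ← weightedSq_add_add_weightedSq_sub]
  rcases hc with rfl | rfl
  · ring
  · rw [← neg_sub a b, weightedSq_neg]; ring

/-- The parallelogram law for the objective. -/
lemma cost_midpoint {ζ ζ' : Decision n n₁ m} (h : S.Feasible u y T ζ)
    (h' : S.Feasible u y T ζ') :
    4 * S.cost u y xbar T (midpoint ζ ζ') + S.windowEnergy T (fun k => ζ.x k - ζ'.x k) =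
      2 * S.cost u y xbar T ζ + 2 * S.cost u y xbar T ζ' := by
  obtain ⟨-, -, -, h4, h5⟩ := h
  obtain ⟨-, -, -, h4', h5'⟩ := h'
  unfold cost windowEnergy arrivalCost
  set s := S.windowStart T
  have e1 := weightedSq_half_add (S.covMinus (s - 1))
    (S.E *ᵥ ζ.x s - S.A *ᵥ S.kalman u y xbar (s - 1) - S.B *ᵥ u (s - 1))
    (S.E *ᵥ ζ'.x s - S.A *ᵥ S.kalman u y xbar (s - 1) - S.B *ᵥ u (s - 1))
    (S.E *ᵥ (ζ.x s - ζ'.x s)) (Or.inl (by rw [Matrix.mulVec_sub]; abel))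
  have e1' : S.E *ᵥ (midpoint ζ ζ').x s - S.A *ᵥ S.kalman u y xbar (s - 1) - S.B *ᵥ u (s - 1) =
      (1 / 2 : ℝ) • (S.E *ᵥ ζ.x s - S.A *ᵥ S.kalman u y xbar (s - 1) - S.B *ᵥ u (s - 1)) +
      (1 / 2 : ℝ) • (S.E *ᵥ ζ'.x s - S.A *ᵥ S.kalman u y xbar (s - 1) - S.B *ᵥ u (s - 1)) := by
    simp only [midpoint, Matrix.mulVec_add, Matrix.mulVec_smul]
    module
  rw [← e1'] at e1
  have e2 : 4 * ∑ k ∈ Finset.Ico s T, weightedSq S.Q ((midpoint ζ ζ').w k) +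
      ∑ k ∈ Finset.Ico s T, weightedSq S.Q
        (S.E *ᵥ (ζ.x (k + 1) - ζ'.x (k + 1)) - S.A *ᵥ (ζ.x k - ζ'.x k)) =
      2 * ∑ k ∈ Finset.Ico s T, weightedSq S.Q (ζ.w k) +
        2 * ∑ k ∈ Finset.Ico s T, weightedSq S.Q (ζ'.w k) := by
    simp only [Finset.mul_sum, ← Finset.sum_add_distrib]
    refine Finset.sum_congr rfl fun k hk => weightedSq_half_add _ _ _ _ (Or.inl ?_)
    rw [Matrix.mulVec_sub, Matrix.mulVec_sub, h4 k hk, h4' k hk]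
    abel
  have e3 : 4 * ∑ k ∈ Finset.Ico (s - 1) T, weightedSq S.R ((midpoint ζ ζ').v k) +
      ∑ k ∈ Finset.Ico (s - 1) T, weightedSq S.R (S.H *ᵥ (ζ.x (k + 1) - ζ'.x (k + 1))) =
      2 * ∑ k ∈ Finset.Ico (s - 1) T, weightedSq S.R (ζ.v k) +
        2 * ∑ k ∈ Finset.Ico (s - 1) T, weightedSq S.R (ζ'.v k) := by
    simp only [Finset.mul_sum, ← Finset.sum_add_distrib]
    refine Finset.sum_congr rfl fun k hk => weightedSq_half_add _ _ _ _ (Or.inr ?_)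
    rw [Matrix.mulVec_sub, sub_eq_sub_iff_add_eq_add, ← h5 k hk, add_comm (ζ'.v k), ← h5' k hk]
  linarith

lemma IsRegular.cost_nonneg (h : S.IsRegular) (ζ : Decision n n₁ m) :
    0 ≤ S.cost u y xbar T ζ := by
  have h1 := weightedSq_nonneg (h.posDef_covMinus (S.windowStart T - 1))
  have h2 := fun k => weightedSq_nonneg h.posDef_Q (ζ.w k)
  have h3 := fun k => weightedSq_nonneg h.posDef_R (ζ.v k)
  exact add_nonneg (add_nonneg (h1 _) (Finset.sum_nonneg fun k _ => h2 k))
    (Finset.sum_nonneg fun k _ => h3 k)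

/-- The noise-free trajectory as a decision. -/
def trueDecision (n₁ m : ℕ) (x : ℕ → Fin n → ℝ) : Decision n n₁ m := ⟨x, 0, 0⟩

lemma IsTrueTrajectory.feasible (hx : S.IsTrueTrajectory u y x) (hW₀ : 0 ∈ S.W) (hV₀ : 0 ∈ S.V)
    (T : ℕ) : S.Feasible u y T (trueDecision n₁ m x) := by
  refine ⟨fun k _ => hx.2.2 k, fun k _ => hW₀, fun k _ => hV₀, fun k _ => ?_, fun k _ => ?_⟩
  · simpa [trueDecision] using hx.1 k
  · simpa [trueDecision] using hx.2.1 k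

/-- All noise terms vanish, and the arrival term sees only the propagated filter error, up to sign.
-/
lemma IsTrueTrajectory.cost_eq (hx : S.IsTrueTrajectory u y x) (T : ℕ) :
    S.cost u y xbar T (trueDecision n₁ m x) =
      S.predictedWeight u y x xbar (S.windowStart T - 1) := by
  obtain ⟨t, ht⟩ : ∃ t, S.windowStart T = t + 1 := ⟨S.windowStart T - 1, by
    have := S.one_le_windowStart T; omega⟩
  have h1 : S.E *ᵥ x (t + 1) - S.A *ᵥ S.kalman u y xbar t - S.B *ᵥ u t =
      -(S.A *ᵥ S.kalmanError u y x xbar t) := by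
    rw [hx.1 t, kalmanError, Matrix.mulVec_sub]
    abel
  simp [cost, trueDecision, arrivalCost, predictedWeight, weightedSq_zero, ht, h1, weightedSq_neg]

/-- The decision with a given state sequence that satisfies the system equations. -/
def decisionOf (S : Estimator n n₁ m q) (u : ℕ → Fin q → ℝ) (y : ℕ → Fin m → ℝ)
    (x : ℕ → Fin n → ℝ) : Decision n n₁ m where
  x := x
  w k := S.E *ᵥ x (k + 1) - S.A *ᵥ x k - S.B *ᵥ u k
  v k := y (k + 1) - S.H *ᵥ x (k + 1)

lemma Feasible.w_eq {ζ : Decision n n₁ m} (h : S.Feasible u y T ζ) {k : ℕ}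
    (hk : k ∈ Finset.Ico (S.windowStart T) T) :
    ζ.w k = S.E *ᵥ ζ.x (k + 1) - S.A *ᵥ ζ.x k - S.B *ᵥ u k := by
  rw [h.2.2.2.1 k hk]; abel

lemma Feasible.v_eq {ζ : Decision n n₁ m} (h : S.Feasible u y T ζ) {k : ℕ}
    (hk : k ∈ Finset.Ico (S.windowStart T - 1) T) :
    ζ.v k = y (k + 1) - S.H *ᵥ ζ.x (k + 1) := by
  rw [h.2.2.2.2 k hk]; abel

/-- Only the states inside the window matter. -/
lemma Feasible.decisionOf (hT : 1 ≤ T) {ζ : Decision n n₁ m} (h : S.Feasible u y T ζ)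
    {x' : ℕ → Fin n → ℝ} (hx' : ∀ k ∈ Finset.Icc (S.windowStart T) T, x' k = ζ.x k) :
    S.Feasible u y T (S.decisionOf u y x') ∧
      S.cost u y xbar T (S.decisionOf u y x') = S.cost u y xbar T ζ := by
  have hs := S.one_le_windowStart T
  have hsT := S.windowStart_le hT
  have hw : ∀ k ∈ Finset.Ico (S.windowStart T) T, (S.decisionOf u y x').w k = ζ.w k := by
    intro k hk
    rw [h.w_eq hk]
    rw [Finset.mem_Ico] at hk
    simp only [Estimator.decisionOf]
    rw [hx' k (by rw [Finset.mem_Icc]; omega), hx' (k + 1) (by rw [Finset.mem_Icc]; omega)]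
  have hv : ∀ k ∈ Finset.Ico (S.windowStart T - 1) T, (S.decisionOf u y x').v k = ζ.v k := by
    intro k hk
    rw [h.v_eq hk]
    rw [Finset.mem_Ico] at hk
    simp only [Estimator.decisionOf]
    rw [hx' (k + 1) (by rw [Finset.mem_Icc]; omega)]
  refine ⟨⟨fun k hk => ?_, fun k hk => ?_, fun k hk => ?_, fun k _ => ?_, fun k _ => ?_⟩, ?_⟩
  · change x' k ∈ S.X
    rw [hx' k hk]; exact h.1 k hk
  · rw [hw k hk]; exact h.2.1 k hk
  · rw [hv k hk]; exact h.2.2.1 k hk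
  · simp only [Estimator.decisionOf]; abel
  · simp only [Estimator.decisionOf]; abel
  · unfold cost
    rw [Finset.sum_congr rfl fun k hk => congrArg (weightedSq S.Q) (hw k hk),
      Finset.sum_congr rfl fun k hk => congrArg (weightedSq S.R) (hv k hk)]
    simp only [Estimator.decisionOf]
    rw [hx' _ (by rw [Finset.mem_Icc]; omega)]

lemma continuous_cost_decisionOf (S : Estimator n n₁ m q) (u : ℕ → Fin q → ℝ)
    (y : ℕ → Fin m → ℝ) (xbar : Fin n → ℝ) (T : ℕ) :
    Continuous fun x => S.cost u y xbar T (S.decisionOf u y x) := by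
  have hc : ∀ {a : ℕ} (M : Matrix (Fin a) (Fin n) ℝ) (k : ℕ),
      Continuous fun x : ℕ → Fin n → ℝ => M *ᵥ x k := fun M k =>
    Continuous.matrix_mulVec continuous_const (continuous_apply k)
  unfold cost arrivalCost decisionOf
  refine ((((continuous_weightedSq _).comp ?_)).add
    (continuous_finsetSum _ fun k _ => (continuous_weightedSq _).comp ?_)).add
    (continuous_finsetSum _ fun k _ => (continuous_weightedSq _).comp ?_)
  · exact ((hc _ _).sub continuous_const).sub continuous_const
  · exact ((hc _ _).sub (hc _ _)).sub continuous_const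
  · exact continuous_const.sub (hc _ _)

lemma isClosed_feasible_decisionOf (hX : IsClosed S.X) (hW : IsClosed S.W) (hV : IsClosed S.V)
    (u : ℕ → Fin q → ℝ) (y : ℕ → Fin m → ℝ) (T : ℕ) :
    IsClosed {x | S.Feasible u y T (S.decisionOf u y x)} := by
  have hc : ∀ {a : ℕ} (M : Matrix (Fin a) (Fin n) ℝ) (k : ℕ),
      Continuous fun x : ℕ → Fin n → ℝ => M *ᵥ x k := fun M k =>
    Continuous.matrix_mulVec continuous_const (continuous_apply k)
  have heq : {x | S.Feasible u y T (S.decisionOf u y x)} =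
      (⋂ k ∈ Finset.Icc (S.windowStart T) T, {x | x k ∈ S.X}) ∩
      ((⋂ k ∈ Finset.Ico (S.windowStart T) T,
        {x | S.E *ᵥ x (k + 1) - S.A *ᵥ x k - S.B *ᵥ u k ∈ S.W}) ∩
      (⋂ k ∈ Finset.Ico (S.windowStart T - 1) T, {x | y (k + 1) - S.H *ᵥ x (k + 1) ∈ S.V})) := by
    ext x
    simp only [Set.mem_inter_iff, Set.mem_iInter, Set.mem_ofPred_eq]
    refine ⟨fun h => ⟨h.1, h.2.1, h.2.2.1⟩, fun h => ⟨h.1, h.2.1, h.2.2, ?_, ?_⟩⟩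
    · intro k _; simp only [Estimator.decisionOf]; abel
    · intro k _; simp only [Estimator.decisionOf]; abel
  rw [heq]
  refine (isClosed_biInter fun k _ => hX.preimage (continuous_apply k)).inter
    ((isClosed_biInter fun k _ => hW.preimage ?_).inter
      (isClosed_biInter fun k _ => hV.preimage ?_))
  · exact ((hc _ _).sub (hc _ _)).sub continuous_const
  · exact continuous_const.sub (hc _ _)

/-- A quantitative form of the strict convexity of the objective. -/
lemma IsRegular.exists_normSq_sub_le (h : S.IsRegular) :
    ∃ c : ℝ, 0 ≤ c ∧ ∀ (u : ℕ → Fin q → ℝ) (y : ℕ → Fin m → ℝ)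
      (xbar : Fin n → ℝ) (T : ℕ) (ζ ζ' : Decision n n₁ m), 1 ≤ T → S.Feasible u y T ζ →
      S.Feasible u y T ζ' → ∀ k ∈ Finset.Icc (S.windowStart T) T, normSq (ζ.x k - ζ'.x k) ≤
        c * (2 * S.cost u y xbar T ζ + 2 * S.cost u y xbar T ζ' -
          4 * S.cost u y xbar T (Estimator.midpoint ζ ζ')) := by
  obtain ⟨c, hc, hb⟩ := h.exists_normSq_le_windowEnergy
  refine ⟨c, hc, fun u y xbar T ζ ζ' hT hζ hζ' k hk => ?_⟩
  rw [← cost_midpoint hζ hζ', add_sub_cancel_left]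
  exact hb T hT (fun k => ζ.x k - ζ'.x k) k hk

end Window

end Estimator

/-! ### Existence, uniqueness and convergence of the estimates -/

namespace Estimator

variable {n n₁ m q : ℕ} {S : Estimator n n₁ m q}

/-- The assumptions on the constraint sets. -/
structure HasAdmissibleConstraints (S : Estimator n n₁ m q) : Prop where
  polyhedral_X : IsPolyhedral S.X
  polyhedral_W : IsPolyhedral S.W
  polyhedral_V : IsPolyhedral S.V
  zero_mem_W : 0 ∈ S.W
  zero_mem_V : 0 ∈ S.V

variable {u : ℕ → Fin q → ℝ} {y : ℕ → Fin m → ℝ} {x : ℕ → Fin n → ℝ}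

/-- A competitor cheaper than the true trajectory stays within a fixed distance of it throughout the
window. The cost thus only has to be minimized over a closed subset of a product of balls, compact
by Tychonoff. -/
lemma IsRegular.exists_isOptimal (h : S.IsRegular) (hS : S.HasAdmissibleConstraints)
    (hx : S.IsTrueTrajectory u y x) (xbar : Fin n → ℝ) {T : ℕ} (hT : 1 ≤ T) :
    ∃ ζ, S.IsOptimal u y xbar T ζ := by
  classical
  obtain ⟨c, hc, hb⟩ := h.exists_normSq_sub_le
  have htrue := hx.feasible hS.zero_mem_W hS.zero_mem_V T
  set α := S.cost u y xbar T (trueDecision n₁ m x) with hα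
  -- For a competitor of cost below `α`, the parallelogram defect is at most `2α + 2α`, the midpoint
  -- cost being nonnegative.
  set r := √(c * (4 * α)) with hr
  set K : Set (ℕ → Fin n → ℝ) :=
    {z | S.Feasible u y T (S.decisionOf u y z)} ∩
      (Set.univ.pi fun k => Metric.closedBall (x k) r) with hK
  have hKc : IsCompact K := (isCompact_univ_pi fun k => isCompact_closedBall _ _).inter_left
    (isClosed_feasible_decisionOf hS.polyhedral_X.isClosed hS.polyhedral_W.isClosed
      hS.polyhedral_V.isClosed u y T)
  have hx' := htrue.decisionOf (xbar := xbar) hT (x' := x) fun _ _ => rfl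
  have hxK : x ∈ K :=
    ⟨hx'.1, fun k _ => Metric.mem_closedBall_self (Real.sqrt_nonneg _)⟩
  obtain ⟨z, hzK, hz⟩ := hKc.exists_isMinOn ⟨x, hxK⟩
    (S.continuous_cost_decisionOf u y xbar T).continuousOn
  refine ⟨S.decisionOf u y z, hzK.1, fun ζ hζ => ?_⟩
  have hzx : S.cost u y xbar T (S.decisionOf u y z) ≤ α := (hz hxK).trans hx'.2.le
  by_cases hle : α ≤ S.cost u y xbar T ζ
  · exact hzx.trans hle
  push Not at hle
  -- States outside the window are free, so they are reset to `x` to land in the product of balls.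
  set z' : ℕ → Fin n → ℝ := fun k => if k ∈ Finset.Icc (S.windowStart T) T then ζ.x k else x k
    with hz'
  obtain ⟨hf, hcost⟩ := hζ.decisionOf (xbar := xbar) hT (x' := z') fun k hk => if_pos hk
  rw [← hcost]
  refine hz ⟨hf, fun k _ => ?_⟩
  by_cases hk : k ∈ Finset.Icc (S.windowStart T) T
  · have h1 := hb u y xbar T ζ _ hT hζ htrue k hk
    have h2 : normSq (ζ.x k - x k) ≤ c * (4 * α) := by
      refine h1.trans (mul_le_mul_of_nonneg_left ?_ hc)
      have := h.cost_nonneg (u := u) (y := y) (xbar := xbar) (T := T)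
        (Estimator.midpoint ζ (trueDecision n₁ m x))
      linarith
    rw [mem_closedBall_iff_norm]
    simp only [hz', if_pos hk]
    refine (pi_norm_le_iff_of_nonneg (Real.sqrt_nonneg _)).mpr fun i => ?_
    rw [Real.norm_eq_abs]
    refine Real.abs_le_sqrt (le_trans ?_ h2)
    rw [normSq_eq_sum]
    exact Finset.single_le_sum (f := fun i => (ζ.x k - x k) i ^ 2) (fun j _ => sq_nonneg _)
      (Finset.mem_univ i)
  · simp only [hz', if_neg hk]
    exact Metric.mem_closedBall_self (Real.sqrt_nonneg _)

/-- The midpoint of two minimizers is feasible by convexity and cannot cost less, so the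
parallelogram defect is nonpositive. -/
lemma IsRegular.isEstimate_unique (h : S.IsRegular) (hS : S.HasAdmissibleConstraints)
    {xbar : Fin n → ℝ} {T : ℕ} (hT : 1 ≤ T) {z z' : Fin n → ℝ}
    (hz : S.IsEstimate u y xbar T z) (hz' : S.IsEstimate u y xbar T z') : z = z' := by
  obtain ⟨ζ, hζ, rfl⟩ := hz
  obtain ⟨ζ', hζ', rfl⟩ := hz'
  obtain ⟨c, hc, hb⟩ := h.exists_normSq_sub_le
  have hmid := hζ.1.midpoint hS.polyhedral_X.convex hS.polyhedral_W.convex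
    hS.polyhedral_V.convex hζ'.1
  have h1 := hb u y xbar T ζ ζ' hT hζ.1 hζ'.1 T (Finset.mem_Icc.mpr ⟨S.windowStart_le hT, le_rfl⟩)
  have h2 : c * (2 * S.cost u y xbar T ζ + 2 * S.cost u y xbar T ζ' -
      4 * S.cost u y xbar T (Estimator.midpoint ζ ζ')) ≤ 0 :=
    mul_nonpos_of_nonneg_of_nonpos hc (by linarith [hζ.2 _ hmid, hζ'.2 _ hmid])
  exact sub_eq_zero.mp (normSq_eq_zero.mp (le_antisymm (h1.trans h2) (normSq_nonneg _)))

/-- The estimation error is bounded by the error of the unconstrained filter before the window. -/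
lemma IsRegular.exists_estimate_error_le (h : S.IsRegular) (hS : S.HasAdmissibleConstraints) :
    ∃ c : ℝ, 0 ≤ c ∧ ∀ (u : ℕ → Fin q → ℝ) (y : ℕ → Fin m → ℝ) (x : ℕ → Fin n → ℝ)
      (xbar : Fin n → ℝ) (T : ℕ) (z : Fin n → ℝ), 1 ≤ T → S.IsTrueTrajectory u y x →
      S.IsEstimate u y xbar T z →
        normSq (z - x T) ≤ c * S.predictedWeight u y x xbar (S.windowStart T - 1) := by
  obtain ⟨c, hc, hb⟩ := h.exists_normSq_sub_le
  -- The minimizer costs no more than the true trajectory, so the defect is at most four times the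
  -- cost of the latter.
  refine ⟨4 * c, by positivity, fun u y x xbar T z hT hx hz => ?_⟩
  obtain ⟨ζ, hζ, rfl⟩ := hz
  have htrue := hx.feasible hS.zero_mem_W hS.zero_mem_V T
  have h1 := hb u y xbar T ζ _ hT hζ.1 htrue T (Finset.mem_Icc.mpr ⟨S.windowStart_le hT, le_rfl⟩)
  refine h1.trans ?_
  have h2 := hζ.2 _ htrue
  have h3 := h.cost_nonneg (u := u) (y := y) (xbar := xbar) (T := T)
    (Estimator.midpoint ζ (trueDecision n₁ m x))
  rw [mul_comm 4 c, mul_assoc, ← hx.cost_eq (xbar := xbar)]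
  exact mul_le_mul_of_nonneg_left (by linarith) hc

lemma IsRegular.tendsto_estimate_error (h : S.IsRegular) (hS : S.HasAdmissibleConstraints)
    (hx : S.IsTrueTrajectory u y x) {xbar : Fin n → ℝ} {xhat : ℕ → Fin n → ℝ}
    (hxhat : S.IsEstimateSequence u y xbar xhat) :
    Filter.Tendsto (fun T => euclNorm (xhat T - x T)) Filter.atTop (nhds 0) := by
  obtain ⟨c, hc, hb⟩ := h.exists_estimate_error_le hS
  have hs : Filter.Tendsto (fun T => S.windowStart T - 1) Filter.atTop Filter.atTop := by
    refine Filter.tendsto_atTop_mono (f := fun T => T - (S.N + 1)) (fun T => ?_)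
      (Filter.tendsto_sub_atTop_nat _)
    have : T - S.N ≤ S.windowStart T := le_max_right _ _
    change T - (S.N + 1) ≤ S.windowStart T - 1
    omega
  have h1 := ((h.tendsto_predictedWeight hx xbar).comp hs).const_mul c
  rw [mul_zero] at h1
  have h2 : Filter.Tendsto (fun T => normSq (xhat T - x T)) Filter.atTop (nhds 0) := by
    refine squeeze_zero' (.of_forall fun T => normSq_nonneg _) ?_ h1
    filter_upwards [Filter.eventually_ge_atTop 1] with T hT
    exact hb u y x xbar T _ hT hx (hxhat T hT)
  have h3 := h2.sqrt
  rw [Real.sqrt_zero] at h3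
  simpa only [euclNorm_eq_sqrt] using h3

/-- The estimation error is bounded, uniformly in time, by the equation error of the initial
estimate. -/
lemma IsRegular.exists_euclNorm_estimate_error_le (h : S.IsRegular)
    (hS : S.HasAdmissibleConstraints) :
    ∃ c : ℝ, 0 ≤ c ∧ ∀ (u : ℕ → Fin q → ℝ) (y : ℕ → Fin m → ℝ) (x : ℕ → Fin n → ℝ)
      (xbar : Fin n → ℝ) (T : ℕ) (z : Fin n → ℝ), 1 ≤ T → S.IsTrueTrajectory u y x →
      S.IsEstimate u y xbar T z →
        euclNorm (z - x T) ≤ c * euclNorm (S.E *ᵥ x 1 - S.A *ᵥ xbar - S.B *ᵥ u 0) := by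
  obtain ⟨c, hc, hb⟩ := h.exists_estimate_error_le hS
  obtain ⟨cW, hcW, hW⟩ := exists_weightedSq_le (S.covMinus 0)
  refine ⟨√(c * cW), Real.sqrt_nonneg _, fun u y x xbar T z hT hx hz => ?_⟩
  rw [euclNorm_eq_sqrt, euclNorm_eq_sqrt, ← Real.sqrt_mul (by positivity)]
  refine Real.sqrt_le_sqrt ((hb u y x xbar T z hT hx hz).trans ?_)
  rw [mul_assoc]
  refine mul_le_mul_of_nonneg_left ?_ hc
  -- Monotonicity moves the bound back to time `0`, where the propagated error is, up to sign, the
  -- initial equation error; hence the constant is independent of `T`.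
  refine (h.antitone_predictedWeight hx xbar (Nat.zero_le _)).trans ?_
  have h1 : S.E *ᵥ x 1 - S.A *ᵥ xbar - S.B *ᵥ u 0 = -(S.A *ᵥ S.kalmanError u y x xbar 0) := by
    rw [hx.1 0, kalmanError, kalman, Matrix.mulVec_sub]
    abel
  rw [h1, normSq_neg]
  exact hW _

end Estimator

end DescriptorMHE

end

theorem mainTheorem2 {n n₁ m q : ℕ} (S : DescriptorMHE.Estimator n n₁ m q)
    (hQ : S.Q.PosDef) (hR : S.R.PosDef) (hP₀ : S.P₀.PosDef)
    (hX : DescriptorMHE.IsPolyhedral S.X)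
    (hW : DescriptorMHE.IsPolyhedral S.W) (hW₀ : (0 : Fin n₁ → ℝ) ∈ interior S.W)
    (hV : DescriptorMHE.IsPolyhedral S.V) (hV₀ : (0 : Fin m → ℝ) ∈ interior S.V)
    (hdet : S.toDescriptorSystem.Detectable)
    (hstab : S.toDescriptorSystem.Stabilizable S.Q S.R) :
    (∀ (u : ℕ → Fin q → ℝ) (y : ℕ → Fin m → ℝ) (x : ℕ → Fin n → ℝ) (xbar : Fin n → ℝ),
      S.IsTrueTrajectory u y x →
        (∀ T, 1 ≤ T → ∃! z, S.IsEstimate u y xbar T z) ∧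
        ∀ xhat : ℕ → Fin n → ℝ, S.IsEstimateSequence u y xbar xhat →
          Filter.Tendsto (fun T => DescriptorMHE.euclNorm (xhat T - x T))
            Filter.atTop (nhds 0)) ∧
    S.IsAsymptoticallyStableObserver := by
  have h : S.IsRegular := ⟨hQ, hR, hP₀, hdet⟩
  have hS : S.HasAdmissibleConstraints :=
    ⟨hX, hW, hV, interior_subset hW₀, interior_subset hV₀⟩
  refine ⟨fun u y x xbar hx => ⟨fun T hT => ?_, fun xhat hxhat =>
    h.tendsto_estimate_error hS hx hxhat⟩, fun ε hε => ?_, fun u y x xbar xhat hx hxhat =>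
    h.tendsto_estimate_error hS hx hxhat⟩
  · obtain ⟨ζ, hζ⟩ := h.exists_isOptimal hS hx xbar hT
    exact ⟨ζ.x T, ⟨ζ, hζ, rfl⟩, fun z hz => h.isEstimate_unique hS hT hz ⟨ζ, hζ, rfl⟩⟩
  · obtain ⟨c, hc, hb⟩ := h.exists_euclNorm_estimate_error_le hS
    -- The error bound holds for every `T ≥ 1`, so the waiting time is `1`; `c + 1` avoids division
    -- by zero when `c = 0`.
    refine ⟨ε / (c + 1), by positivity, 1, one_pos, fun u y x xbar xhat hx hxhat hδ T hT => ?_⟩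
    refine (hb u y x xbar T _ hT hx (hxhat T hT)).trans ?_
    calc c * DescriptorMHE.euclNorm (S.E *ᵥ x 1 - S.A *ᵥ xbar - S.B *ᵥ u 0)
        ≤ c * (ε / (c + 1)) := by gcongr
      _ ≤ (c + 1) * (ε / (c + 1)) := by gcongr; linarith
      _ = ε := mul_div_cancel₀ _ (by positivity)
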